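/- Let $\mathbb C^7=\operatorname{Im}(\mathbb O)\otimes\mathbb C$ carry the complex bilinear extension $\langle x,y\rangle=\sum_i x_iy_i$ of the standard inner product and coordinatewise conjugation, both with respect to the imaginary units $e_1,\dots,e_7$. Let $^\perp$ denote the orthogonal complement with respect to $\langle\cdot,\cdot\rangle$, and let $x\cdot y\in\mathbb C^7$ denote the octonionic-imaginary part of the product of $x,y\in\mathbb C^7$; here the octonion multiplication is given by $e_i^2=-1$, $e_je_i=-e_ie_j$ for $i\ne j$, and $e_1e_2=-e_5$, $e_1e_3=-e_6$, $e_1e_4=-e_7$, $e_1e_5=e_2$, $e_1e_6=e_3$, $e_1e_7=e_4$, $e_2e_3=-e_7$, $e_2e_4=e_6$, $e_2e_5=-e_1$, $e_2e_6=-e_4$, $e_2e_7=e_3$, $e_3e_4=-e_5$, $e_3e_5=e_4$, $e_3e_6=-e_1$, $e_3e_7=-e_2$, $e_4e_5=-e_3$, $e_4e_6=e_2$, $e_4e_7=-e_1$, $e_5e_6=e_7$, $e_5e_7=-e_6$, $e_6e_7=e_5$. A complex coassociative plane is an isotropic $2$-plane $\mathcal C\subset\mathbb C^7$ with $\mathcal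 C\cdot\mathcal C=0$. For an isotropic line $L$ and $\alpha\in\mathbb C\setminus\mathbb R$ let \[ p_{\alpha,L}(\lambda)=\frac{\lambda-\bar\alpha}{\lambda-\alpha}\,\pi_{\overline L}+\pi_{(L\oplus\overline L)^\perp}+\frac{\lambda-\alpha}{\lambda-\bar\alpha}\,\pi_L , \] where the $\pi$'s are the projections of the decomposition $\mathbb C^7=L\oplus(L\oplus\overline L)^\perp\oplus\overline L$. A pair $(L,K)$ of isotropic lines satisfies the $G_2$ pair condition if $K\subset\overline L^{\perp}$ and $L\oplus\pi_{(L\oplus\overline L)^\perp}K$ is a complex coassociative plane; for such a pair put $p_{\alpha,L,K}=p_{\alpha,L}\,p_{\alpha,K}$. For a rational loop $h$ of invertible matrices that is holomorphic at $\alpha$ (that is, it has no pole at $\alpha$ and $h(\alpha)$ is invertible), put \[ p_{\alpha,K}*h=p_{\alpha,K}\,h\,p_{\alpha,h(\alpha)^{-1}K}^{-1}. \] Corollary (Permutability). Let $(L,K)$ and $(M,N)$ be pairs of isotropic lines in $\mathbb C^7$ satisfying the $G_2$ pair condition, and let $\alpha,\beta\in\mathbb C\setminus\mathbb R$ with $\alpha\ne\beta,\bar\beta$.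 Put \begin{align*} K'&=p_{\beta,M,N}(\alpha)K, & L'&=(p_{\alpha,K'}*p_{\beta,M,N})(\alpha)L,\\ N'&=p_{\alpha,L,K}(\beta)N, & M'&=(p_{\beta,N'}*p_{\alpha,L,K})(\beta)M . \end{align*} These lines are well defined: $p_{\beta,M,N}$ and $p_{\alpha,K'}*p_{\beta,M,N}$ are holomorphic at $\alpha$, and $p_{\alpha,L,K}$ and $p_{\beta,N'}*p_{\alpha,L,K}$ are holomorphic at $\beta$, after filling in removable singularities. Moreover $(L',K')$ and $(M',N')$ are again pairs of isotropic lines satisfying the $G_2$ pair condition, and \[ p_{\alpha,L',K'}\,p_{\beta,M,N}=p_{\beta,M',N'}\,p_{\alpha,L,K}. \] -/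

import Mathlib

noncomputable section

namespace G2Loop

/-- The complex space `ℂ⁷ = Im(𝕆) ⊗ ℂ`, with its standard Hermitian inner product. The
coordinates `0, …, 6` are those with respect to the octonionic imaginary units `e₁, …, e₇`. -/
abbrev V : Type := EuclideanSpace ℂ (Fin 7)

/-- The octonionic-imaginary part `x · y` of the product of `x, y ∈ Im(𝕆) ⊗ ℂ`, for the
multiplication table given (up to `eⱼ eᵢ = - eᵢ eⱼ` for `i ≠ j`, and `eᵢ² = -1`) by
`e₁e₂ = -e₅`, `e₁e₃ = -e₆`, `e₁e₄ = -e₇`, `e₁e₅ = e₂`, `e₁e₆ = e₃`, `e₁e₇ = e₄`,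
`e₂e₃ = -e₇`, `e₂e₄ = e₆`, `e₂e₅ = -e₁`, `e₂e₆ = -e₄`, `e₂e₇ = e₃`,
`e₃e₄ = -e₅`, `e₃e₅ = e₄`, `e₃e₆ = -e₁`, `e₃e₇ = -e₂`,
`e₄e₅ = -e₃`, `e₄e₆ = e₂`, `e₄e₇ = -e₁`, `e₅e₆ = e₇`, `e₅e₇ = -e₆`, `e₆e₇ = e₅`. -/
def octProd (x y : V) : V :=
  !₂[-(x 1 * y 4 - x 4 * y 1) - (x 2 * y 5 - x 5 * y 2) - (x 3 * y 6 - x 6 * y 3),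
     (x 0 * y 4 - x 4 * y 0) - (x 2 * y 6 - x 6 * y 2) + (x 3 * y 5 - x 5 * y 3),
     (x 0 * y 5 - x 5 * y 0) + (x 1 * y 6 - x 6 * y 1) - (x 3 * y 4 - x 4 * y 3),
     (x 0 * y 6 - x 6 * y 0) - (x 1 * y 5 - x 5 * y 1) + (x 2 * y 4 - x 4 * y 2),
     -(x 0 * y 1 - x 1 * y 0) - (x 2 * y 3 - x 3 * y 2) + (x 5 * y 6 - x 6 * y 5),
     -(x 0 * y 2 - x 2 * y 0) + (x 1 * y 3 - x 3 * y 1) - (x 4 * y 6 - x 6 * y 4),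
     -(x 0 * y 3 - x 3 * y 0) - (x 1 * y 2 - x 2 * y 1) + (x 4 * y 5 - x 5 * y 4)]

/-- The symmetric complex bilinear form `⟨x, y⟩ = ∑ᵢ xᵢ yᵢ` on `ℂ⁷`. -/
def bil (x y : V) : ℂ := ∑ i, x i * y i

/-- The orthogonal complement `W^⊥` with respect to the complex bilinear form. -/
def perp (W : Submodule ℂ V) : Submodule ℂ V where
  carrier := {x | ∀ w ∈ W, bil x w = 0}
  zero_mem' := by
    intro w _
    simp [bil]
  add_mem' := by
    intro a b ha hb w hw
    have h1 := ha w hw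
    have h2 := hb w hw
    simp only [bil] at h1 h2 ⊢
    simp [add_mul, Finset.sum_add_distrib, h1, h2]
  smul_mem' := by
    intro c a ha w hw
    have h1 := ha w hw
    simp only [bil] at h1 ⊢
    simp [mul_assoc, ← Finset.mul_sum, h1]

/-- Coordinatewise complex conjugation on `ℂ⁷`. -/
def conjMap : V →ₛₗ[starRingEnd ℂ] V where
  toFun x := WithLp.toLp 2 fun i => starRingEnd ℂ (x i)
  map_add' x y := by
    ext i
    simp
  map_smul' c x := by
    ext i
    simp

/-- The conjugate subspace `W̄`. -/
def conjSub (W : Submodule ℂ V) : Submodule ℂ V := W.map conjMap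

/-- `W` is isotropic for the complex bilinear form. -/
def IsIsotropic (W : Submodule ℂ V) : Prop := ∀ x ∈ W, ∀ y ∈ W, bil x y = 0

/-- An isotropic line in `ℂ⁷`. -/
def IsIsotropicLine (L : Submodule ℂ V) : Prop :=
  Module.finrank ℂ L = 1 ∧ IsIsotropic L

/-- A complex coassociative plane: an isotropic `2`-plane `C` with `C · C = 0`. -/
def IsComplexCoassociative (C : Submodule ℂ V) : Prop :=
  Module.finrank ℂ C = 2 ∧ IsIsotropic C ∧ ∀ x ∈ C, ∀ y ∈ C, octProd x y = 0

/-- The matrix of the Hermitian orthogonal projection onto `W`. For an isotropic line `L` the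
decomposition `ℂ⁷ = L ⊕ (L ⊕ L̄)^⊥ ⊕ L̄` is Hermitian orthogonal, so the projections onto
its summands along the other two are the Hermitian orthogonal ones. -/
def projMat (W : Submodule ℂ V) : Matrix (Fin 7) (Fin 7) ℂ :=
  (Matrix.toEuclideanCLM (n := Fin 7) (𝕜 := ℂ)).symm W.starProjection

/-- The image `A W` of a subspace under a matrix. -/
def image (A : Matrix (Fin 7) (Fin 7) ℂ) (W : Submodule ℂ V) : Submodule ℂ V :=
  W.map (Matrix.toEuclideanLin A)

/-- The condition on a pair of lines: `L` and `K` are isotropic lines, `K ⊆ L̄^⊥`, and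
`L ⊕ π_{(L ⊕ L̄)^⊥} K` is complex coassociative (the sum is direct since it has to be a plane). -/
structure IsG2Pair (L K : Submodule ℂ V) : Prop where
  isotropicLine_left : IsIsotropicLine L
  isotropicLine_right : IsIsotropicLine K
  le_perp : K ≤ perp (conjSub L)
  coassociative :
    IsComplexCoassociative (L ⊔ image (projMat (perp (L ⊔ conjSub L))) K)

/-- A rational loop of endomorphisms of `ℂ⁷`: a matrix whose entries are rational functions of the
loop parameter `λ`. -/
abbrev Loop : Type := Matrix (Fin 7) (Fin 7) (RatFunc ℂ)

/-- The value `g(a)` of a rational loop at a point `a`, read off from the reduced fractions, so that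
removable singularities are filled in. -/
def evalAt (g : Loop) (a : ℂ) : Matrix (Fin 7) (Fin 7) ℂ :=
  g.map (RatFunc.eval (RingHom.id ℂ) a)

/-- The loop `g` is holomorphic at `a` as a loop of invertible matrices: no entry has a pole at
`a`, and the value at `a` is invertible. -/
def IsHolomorphicAt (g : Loop) (a : ℂ) : Prop :=
  (∀ i j, (g i j).denom.eval a ≠ 0) ∧ IsUnit (evalAt g a)

/-- The rational function `(λ - a) / (λ - b)`. -/
def mobius (a b : ℂ) : RatFunc ℂ :=
  (RatFunc.X - RatFunc.C a) / (RatFunc.X - RatFunc.C b)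

/-- A constant matrix as a constant loop. -/
def constLoop (A : Matrix (Fin 7) (Fin 7) ℂ) : Loop := A.map RatFunc.C

/-- The loop `p_{α,L}(λ) = ((λ - ᾱ)/(λ - α)) π_{L̄} + π_{(L ⊕ L̄)^⊥} + ((λ - α)/(λ - ᾱ)) π_L`. -/
def simpleLoop (α : ℂ) (L : Submodule ℂ V) : Loop :=
  mobius (starRingEnd ℂ α) α • constLoop (projMat (conjSub L))
    + constLoop (projMat (perp (L ⊔ conjSub L)))
    + mobius α (starRingEnd ℂ α) • constLoop (projMat L)

/-- The product `p_{α,L,K} = p_{α,L} p_{α,K}`. -/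
def pairLoop (α : ℂ) (L K : Submodule ℂ V) : Loop := simpleLoop α L * simpleLoop α K

/-- The dressing-type action `p_{α,K} * h = p_{α,K} h p_{α,K'}⁻¹` with `K' = h(α)⁻¹ K`. -/
def dress (α : ℂ) (K : Submodule ℂ V) (h : Loop) : Loop :=
  simpleLoop α K * h * (simpleLoop α (image (evalAt h α)⁻¹ K))⁻¹

end G2Loop

end

/-!
A loop `p_{α,L}` is orthogonal and real, equals `1` at infinity and has poles only at `α` and `ᾱ`.
Two such loops with disjoint sets of poles can only be equal if both are `1`: their entries have no
poles at all, hence are constant. If `h` is orthogonal and regular at `α` and `h(α)` takes the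
isotropic vector `k` to `k'`, then `p_{α,k'} h p_{α,k}⁻¹` has no pole at `α`, because `h k` differs
from `k'` by a multiple of `λ - α` and is isotropic. This gives `p_{α,L',K'} p_{β,M,N} =
h p_{α,L,K}` with `h` having the poles of `p_{β,M,N}`, and the same with the roles exchanged;
uniqueness of factorizations with disjoint poles then identifies `h` with `p_{β,M',N'}`.

The `G₂` pair condition holds if and only if `p_{α,L,K}` consists of octonion automorphisms and has
a simple pole with nonzero coefficient at `α`. Indeed, a `G₂` pair makes `p_{α,L,K}` a commutator of
`p_{α,L}` with an octonion automorphism that is a product of Eichler transformations, such that the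
two halves of the commutator are automorphisms. Both properties carry over along
`p_{α,L',K'} p_{β,M,N} = h p_{α,L,K}`: the octonion product transported by `h` equals the one
transported by `p_{α,L',K'}`, and the two loops have disjoint poles.
-/

noncomputable section

namespace G2Loop

open Matrix Polynomial
open scoped ComplexConjugate

section RationalFunctions

variable {F : Type*} [Field F]

/-- The local ring of rational functions without a pole at `a`. Poles are read off from the reduced
fraction. -/
def regularAt (a : F) : Subring (RatFunc F) where
  carrier := {f | f.denom.eval a ≠ 0}
  mul_mem' {f g} hf hg := by
    have h := eval_dvd (x := a) (RatFunc.denom_mul_dvd f g)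
    exact ne_zero_of_dvd_ne_zero (by simpa using ⟨hf, hg⟩) h
  one_mem' := by simp
  add_mem' {f g} hf hg := by
    have h := eval_dvd (x := a) (RatFunc.denom_add_dvd f g)
    exact ne_zero_of_dvd_ne_zero (by simpa using ⟨hf, hg⟩) h
  zero_mem' := by simp
  neg_mem' {f} hf := by
    have h := eval_dvd (x := a) (RatFunc.denom_mul_dvd (-1) f)
    rw [neg_one_mul] at h
    refine ne_zero_of_dvd_ne_zero ?_ h
    rw [← map_one (RatFunc.C (K := F)), ← map_neg, RatFunc.denom_C]
    simpa using hf

lemma mem_regularAt {f : RatFunc F} {a : F} : f ∈ regularAt a ↔ f.denom.eval a ≠ 0 := Iff.rfl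

lemma div_mem_regularAt (p : F[X]) {q : F[X]} {a : F} (h : q.eval a ≠ 0) :
    algebraMap F[X] (RatFunc F) p / algebraMap F[X] (RatFunc F) q ∈ regularAt a :=
  ne_zero_of_dvd_ne_zero h (eval_dvd (RatFunc.denom_div_dvd p q))

lemma algebraMap_mem_regularAt (p : F[X]) (a : F) :
    algebraMap F[X] (RatFunc F) p ∈ regularAt a := by
  simpa using div_mem_regularAt p (q := 1) (a := a) (by simp)

lemma C_mem_regularAt (c a : F) : RatFunc.C c ∈ regularAt a :=
  RatFunc.algebraMap_C c ▸ algebraMap_mem_regularAt (C c) a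

/-- The value at `a` of a rational function without a pole at `a`. -/
def valueAt (a : F) : regularAt a →+* F where
  toFun f := RatFunc.eval (RingHom.id F) a f.1
  map_one' := RatFunc.eval_one _ _
  map_mul' f g := RatFunc.eval_mul (RingHom.id F) a f.2 g.2
  map_zero' := RatFunc.eval_zero _ _
  map_add' f g := RatFunc.eval_add (RingHom.id F) a f.2 g.2

lemma valueAt_apply {a : F} (f : regularAt a) :
    valueAt a f = RatFunc.eval (RingHom.id F) a f.1 := rfl

/-- The constants, as rational functions without a pole at `a`. -/
def constAt (a : F) : F →+* regularAt a :=
  RatFunc.C.codRestrict (regularAt a) fun c => C_mem_regularAt c a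

lemma valueAt_constAt (a c : F) : valueAt a (constAt a c) = c := by
  rw [valueAt_apply]
  exact RatFunc.eval_C _ _

lemma exists_eq_X_sub_C_mul {a : F} {f : regularAt a} (h : valueAt a f = 0) :
    ∃ g ∈ regularAt a, (f : RatFunc F) = (RatFunc.X - RatFunc.C a) * g := by
  have hroot : (f : RatFunc F).num.IsRoot a := by
    simpa [valueAt_apply, RatFunc.eval, mem_regularAt.1 f.2] using h
  obtain ⟨q, hq⟩ := dvd_iff_isRoot.2 hroot
  refine ⟨_, div_mem_regularAt q (mem_regularAt.1 f.2), ?_⟩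
  rw [← mul_div_assoc, ← RatFunc.algebraMap_X, ← RatFunc.algebraMap_C, ← map_sub, ← map_mul, ← hq,
    RatFunc.num_div_denom]

/-- The rational function obtained by applying a field homomorphism to all coefficients. -/
def mapCoeff {F' : Type*} [Field F'] (φ : F →+* F') : RatFunc F →+* RatFunc F' :=
  RatFunc.mapRingHom (mapRingHom φ) <|
    nonZeroDivisors_le_comap_nonZeroDivisors_of_injective _ (map_injective φ φ.injective)

lemma mapCoeff_div {F' : Type*} [Field F'] (φ : F →+* F') (p q : F[X]) :
    mapCoeff φ (algebraMap F[X] (RatFunc F) p / algebraMap F[X] (RatFunc F) q) =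
      algebraMap _ _ (p.map φ) / algebraMap _ _ (q.map φ) := by
  rw [mapCoeff, RatFunc.coe_mapRingHom_eq_coe_map, RatFunc.map_apply_div, coe_mapRingHom]

lemma mapCoeff_C {F' : Type*} [Field F'] (φ : F →+* F') (c : F) :
    mapCoeff φ (RatFunc.C c) = RatFunc.C (φ c) := by
  simpa using mapCoeff_div φ (C c) 1

lemma mapCoeff_X {F' : Type*} [Field F'] (φ : F →+* F') :
    mapCoeff φ RatFunc.X = RatFunc.X := by
  simpa using mapCoeff_div φ X 1

lemma mapCoeff_mem_regularAt {F' : Type*} [Field F'] (φ : F →+* F') {f : RatFunc F} {a : F}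
    (hf : f ∈ regularAt a) : mapCoeff φ f ∈ regularAt (φ a) := by
  rw [← RatFunc.num_div_denom f, mapCoeff_div]
  exact div_mem_regularAt _ (by simpa [eval_map_apply] using mem_regularAt.1 hf)

open Classical in
/-- The local ring of rational functions without a pole at infinity. Its residue map is the value at
infinity. -/
abbrev regularAtInfty (F : Type*) [Field F] : ValuationSubring (RatFunc F) :=
  (RatFunc.inftyValuation F).valuationSubring

lemma eq_zero_of_forall_mem_regularAt [IsAlgClosed F] {f : regularAtInfty F}
    (hf : ∀ a, (f : RatFunc F) ∈ regularAt a) (hinfty : IsLocalRing.residue _ f = 0) : f = 0 := by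
  classical
  have hdenom : (f : RatFunc F).denom = 1 := by
    refine (RatFunc.monic_denom _).natDegree_eq_zero.1 ?_
    by_contra h
    obtain ⟨a, ha⟩ := IsAlgClosed.exists_root (f : RatFunc F).denom
      (fun h0 => h (natDegree_eq_of_degree_eq_some h0))
    exact hf a ha
  have hnum : algebraMap F[X] (RatFunc F) (f : RatFunc F).num = f := by
    simpa [hdenom] using RatFunc.num_div_denom (f : RatFunc F)
  by_contra h0
  rw [IsLocalRing.residue_eq_zero_iff, Valuation.mem_maximalIdeal_iff,
    RatFunc.inftyValuation_apply, RatFunc.inftyValuation_of_nonzero F (by simpa using h0), ← hnum,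
    RatFunc.intDegree_polynomial, ← WithZero.exp_zero, WithZero.exp_lt_exp] at hinfty
  omega

end RationalFunctions

section Integrality

variable {R n : Type*} [CommRing R] [Fintype n] {S : Subring R}

lemma dotProduct_mem {v w : n → R} (hv : ∀ i, v i ∈ S) (hw : ∀ i, w i ∈ S) : v ⬝ᵥ w ∈ S :=
  sum_mem fun i _ => mul_mem (hv i) (hw i)

variable [DecidableEq n]

lemma mulVec_mem {A : Matrix n n R} {v : n → R} (hA : A ∈ S.matrix) (hv : ∀ i, v i ∈ S) (i : n) :
    (A *ᵥ v) i ∈ S :=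
  dotProduct_mem (hA i) hv

lemma vecMulVec_mem {v w : n → R} (hv : ∀ i, v i ∈ S) (hw : ∀ i, w i ∈ S) :
    vecMulVec v w ∈ S.matrix :=
  fun i j => S.mul_mem (hv i) (hw j)

lemma transpose_mem {A : Matrix n n R} (hA : A ∈ S.matrix) : Aᵀ ∈ S.matrix :=
  fun i j => hA j i

lemma smul_mem {c : R} {A : Matrix n n R} (hc : c ∈ S) (hA : A ∈ S.matrix) : c • A ∈ S.matrix :=
  fun i j => S.mul_mem hc (hA i j)

end Integrality

section HyperbolicPair

variable {R n : Type*} [CommRing R] [Fintype n]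

/-- A hyperbolic pair: two isotropic vectors `v` and `w` with `v ⬝ᵥ w = 1`. -/
structure IsHyperbolicPair (v w : n → R) : Prop where
  dotProduct_self_left : v ⬝ᵥ v = 0
  dotProduct_self_right : w ⬝ᵥ w = 0
  dotProduct_eq_one : v ⬝ᵥ w = 1

namespace IsHyperbolicPair

variable {v w : n → R}

lemma dotProduct_eq_one' (h : IsHyperbolicPair v w) : w ⬝ᵥ v = 1 :=
  dotProduct_comm v w ▸ h.dotProduct_eq_one

lemma symm (h : IsHyperbolicPair v w) : IsHyperbolicPair w v :=
  ⟨h.dotProduct_self_right, h.dotProduct_self_left, h.dotProduct_eq_one'⟩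

lemma map {R' : Type*} [CommRing R'] (h : IsHyperbolicPair v w) (f : R →+* R') :
    IsHyperbolicPair (f ∘ v) (f ∘ w) := by
  constructor
  · rw [← RingHom.map_dotProduct, h.dotProduct_self_left, map_zero]
  · rw [← RingHom.map_dotProduct, h.dotProduct_self_right, map_zero]
  · rw [← RingHom.map_dotProduct, h.dotProduct_eq_one, map_one]

end IsHyperbolicPair

end HyperbolicPair

section Scaling

variable {R n : Type*} [CommRing R] [DecidableEq n]

/-- For a hyperbolic pair `v`, `w`, the endomorphism that multiplies `v` by `s` and `w` by `t` and
is the identity on the orthogonal complement of both. -/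
def scaling (s t : R) (v w : n → R) : Matrix n n R :=
  1 + (s - 1) • vecMulVec v w + (t - 1) • vecMulVec w v

lemma scaling_swap (s t : R) (v w : n → R) : scaling s t v w = scaling t s w v :=
  add_right_comm _ _ _

lemma transpose_scaling (s t : R) (v w : n → R) : (scaling s t v w)ᵀ = scaling t s v w := by
  simp [scaling, transpose_vecMulVec, add_right_comm]

lemma scaling_one_one (v w : n → R) : scaling 1 1 v w = 1 := by simp [scaling]

lemma scaling_map {R' : Type*} [CommRing R'] (f : R →+* R') (s t : R) (v w : n → R) :
    (scaling s t v w).map f = scaling (f s) (f t) (f ∘ v) (f ∘ w) := by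
  ext i j
  simp [scaling, vecMulVec_apply, one_apply, apply_ite f]

lemma scaling_smul_smul {c d : R} (h : c * d = 1) (s t : R) (v w : n → R) :
    scaling s t (c • v) (d • w) = scaling s t v w := by
  simp [scaling, smul_vecMulVec, vecMulVec_smul, smul_smul, mul_comm d c, h]

lemma scaling_eq_scaling_zero_add (s t : R) (v w : n → R) :
    scaling t s v w = scaling t 0 v w + s • vecMulVec w v := by
  simp only [scaling]
  module

variable [Fintype n]

lemma scaling_mulVec (s t : R) (v w x : n → R) :
    scaling s t v w *ᵥ x = x + ((s - 1) * w ⬝ᵥ x) • v + ((t - 1) * v ⬝ᵥ x) • w := by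
  simp [scaling, add_mulVec, smul_mulVec, vecMulVec_mulVec, smul_smul]

lemma scaling_mulVec_left {v w : n → R} (h : IsHyperbolicPair v w) (s t : R) :
    scaling s t v w *ᵥ v = s • v := by
  rw [scaling_mulVec, h.dotProduct_self_left, h.dotProduct_eq_one']
  module

lemma scaling_mulVec_right {v w : n → R} (h : IsHyperbolicPair v w) (s t : R) :
    scaling s t v w *ᵥ w = t • w := by
  rw [scaling_swap, scaling_mulVec_left h.symm]

lemma scaling_mul_scaling {v w : n → R} (h : IsHyperbolicPair v w) (s t s' t' : R) :
    scaling s t v w * scaling s' t' v w = scaling (s * s') (t * t') v w := by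
  refine ext_of_mulVec_single fun i => ?_
  rw [← mulVec_mulVec, scaling_mulVec s' t', mulVec_add, mulVec_add, mulVec_smul, mulVec_smul,
    scaling_mulVec_left h, scaling_mulVec_right h, scaling_mulVec, scaling_mulVec]
  module

lemma scaling_mem {S : Subring R} {s t : R} {v w : n → R} (hs : s ∈ S) (ht : t ∈ S)
    (hv : ∀ i, v i ∈ S) (hw : ∀ i, w i ∈ S) : scaling s t v w ∈ S.matrix :=
  add_mem (add_mem (one_mem _) (smul_mem (sub_mem hs (one_mem _)) (vecMulVec_mem hv hw)))
    (smul_mem (sub_mem ht (one_mem _)) (vecMulVec_mem hw hv))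

end Scaling

section Dressing

variable {K n : Type*} [Field K] [Fintype n] [DecidableEq n]

/-- With `h v = v' + t z`, the vector `scaling t s v' w' (h v)` is divisible by `t`, since isotropy
of `h v` gives `2 (v' ⬝ᵥ z) = - t (z ⬝ᵥ z)`. -/
lemma scaling_mulVec_add_smul {s t : K} (hst : s * t = 1) (h2 : (2 : K) ≠ 0) {v w z : n → K}
    (h : IsHyperbolicPair v w) (hy : (v + t • z) ⬝ᵥ (v + t • z) = 0) :
    scaling t s v w *ᵥ (v + t • z) =
      t • (z + (1 + (t - 1) * w ⬝ᵥ z) • v - ((1 - t) / 2 * z ⬝ᵥ z) • w) := by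
  have ht : t ≠ 0 := right_ne_zero_of_mul_eq_one hst
  have hvz : v ⬝ᵥ z = -(t / 2 * z ⬝ᵥ z) := by
    simp only [add_dotProduct, dotProduct_add, dotProduct_smul, smul_dotProduct, smul_eq_mul,
      h.dotProduct_self_left, dotProduct_comm z v] at hy
    field_simp
    exact mul_left_cancel₀ ht (by linear_combination hy)
  rw [mulVec_add, mulVec_smul, scaling_mulVec_left h, scaling_mulVec, hvz]
  linear_combination (norm := module) (-(z ⬝ᵥ z) / 2 * t) • congrArg (· • w) hst

variable {S : Subring K} {s t : K} {h : Matrix n n K} {v w v' w' z : n → K}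

lemma scaling_mul_mul_scaling_zero_mem (hst : s * t = 1) (ht : t ∈ S) (horth : hᵀ * h = 1)
    (hh : h ∈ S.matrix) (hvw : IsHyperbolicPair v w) (hv : ∀ i, v i ∈ S) (hw : ∀ i, w i ∈ S)
    (hv' : ∀ i, v' i ∈ S) (hw' : ∀ i, w' i ∈ S) (hz : ∀ i, z i ∈ S)
    (hhv : h *ᵥ v = v' + t • z) :
    scaling t s v' w' * h * scaling t 0 w v ∈ S.matrix := by
  have hscale : scaling t 0 w v ∈ S.matrix := scaling_mem ht S.zero_mem hw hv
  have hrow : v' ᵥ* h ᵥ* scaling t 0 w v = t • (v - (hᵀ *ᵥ z) ᵥ* scaling t 0 w v) := by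
    have htranspose : v' ᵥ* h = v - t • hᵀ *ᵥ z := by
      rw [← mulVec_transpose, ← mulVec_smul, eq_sub_iff_add_eq, ← mulVec_add, ← hhv, mulVec_mulVec,
        horth, one_mulVec]
    have hv_row : v ᵥ* scaling t 0 w v = t • v := by
      rw [← mulVec_transpose, transpose_scaling, scaling_mulVec_right hvw.symm]
    rw [htranspose, sub_vecMul, smul_vecMul, hv_row, smul_sub]
  have hrow_mem (i : n) : (v - (hᵀ *ᵥ z) ᵥ* scaling t 0 w v) i ∈ S := by
    refine sub_mem (hv i) ?_
    rw [← mulVec_transpose]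
    exact mulVec_mem (transpose_mem hscale) (mulVec_mem (transpose_mem hh) hz) i
  have hsplit : scaling t s v' w' * h * scaling t 0 w v =
      scaling t 0 v' w' * h * scaling t 0 w v +
        vecMulVec w' (v - (hᵀ *ᵥ z) ᵥ* scaling t 0 w v) := by
    rw [scaling_eq_scaling_zero_add s t v' w', add_mul, add_mul, smul_mul_assoc, smul_mul_assoc,
      vecMulVec_mul, vecMulVec_mul, hrow, vecMulVec_smul, smul_smul, hst, one_smul]
  rw [hsplit]
  exact add_mem (mul_mem (mul_mem (scaling_mem ht S.zero_mem hv' hw') hh) hscale)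
    (vecMulVec_mem hw' hrow_mem)

/-- Dressing removes the pole: `t` plays the role of `(λ - α)/(λ - ᾱ)`, and `h *ᵥ v = v' + t • z`
says that the value of `h` at `α` takes `v` to `v'`. -/
lemma scaling_mul_mul_scaling_mem (hst : s * t = 1) (ht : t ∈ S) (h2 : (2 : K) ≠ 0)
    (h2S : (2 : K)⁻¹ ∈ S) (horth : hᵀ * h = 1) (hh : h ∈ S.matrix)
    (hvw : IsHyperbolicPair v w) (hvw' : IsHyperbolicPair v' w')
    (hv : ∀ i, v i ∈ S) (hw : ∀ i, w i ∈ S) (hv' : ∀ i, v' i ∈ S) (hw' : ∀ i, w' i ∈ S)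
    (hz : ∀ i, z i ∈ S) (hhv : h *ᵥ v = v' + t • z) :
    scaling t s v' w' * h * scaling s t v w ∈ S.matrix := by
  have hisotropic : (h *ᵥ v) ⬝ᵥ (h *ᵥ v) = 0 := by
    rw [dotProduct_mulVec, vecMul_mulVec, horth, vecMul_one, hvw.dotProduct_self_left]
  have hhalf : (1 - t) / 2 ∈ S := by
    rw [div_eq_mul_inv]
    exact mul_mem (sub_mem S.one_mem ht) h2S
  have hcol : s • (scaling t s v' w' *ᵥ (h *ᵥ v)) =
      z + (1 + (t - 1) * w' ⬝ᵥ z) • v' - ((1 - t) / 2 * z ⬝ᵥ z) • w' := by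
    rw [hhv, scaling_mulVec_add_smul hst h2 hvw' (hhv ▸ hisotropic), smul_smul, hst, one_smul]
  have hcol_mem (i : n) : (s • (scaling t s v' w' *ᵥ (h *ᵥ v))) i ∈ S := by
    rw [hcol]
    exact sub_mem (add_mem (hz i) (mul_mem (add_mem S.one_mem
      (mul_mem (sub_mem ht S.one_mem) (dotProduct_mem hw' hz))) (hv' i)))
      (mul_mem (mul_mem hhalf (dotProduct_mem hz hz)) (hw' i))
  rw [scaling_swap s, scaling_eq_scaling_zero_add s t w v, mul_add, mul_smul_comm, mul_vecMulVec,
    ← smul_vecMulVec, ← mulVec_mulVec]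
  exact add_mem (scaling_mul_mul_scaling_zero_mem hst ht horth hh hvw hv hw hv' hw' hz hhv)
    (vecMulVec_mem hcol_mem hw)

end Dressing

section Dual

variable {n : Type*} [Fintype n]

/-- The multiple of the conjugate of `v` that pairs to `1` with `v ≠ 0`; it spans the line
conjugate to that of `v`. -/
def dual (v : n → ℂ) : n → ℂ := (star v ⬝ᵥ v)⁻¹ • star v

lemma star_dotProduct_self_ne_zero {v : n → ℂ} (hv : v ≠ 0) : star v ⬝ᵥ v ≠ 0 := by
  open ComplexOrder in exact dotProduct_star_self_eq_zero.not.2 hv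

lemma dual_ne_zero {v : n → ℂ} (hv : v ≠ 0) : dual v ≠ 0 :=
  smul_ne_zero (inv_ne_zero (star_dotProduct_self_ne_zero hv)) (star_ne_zero.2 hv)

lemma star_eq_smul_dual {v : n → ℂ} (hv : v ≠ 0) : star v = (star v ⬝ᵥ v) • dual v := by
  rw [dual, smul_smul, mul_inv_cancel₀ (star_dotProduct_self_ne_zero hv), one_smul]

lemma star_dual (v : n → ℂ) : star (dual v) = (star v ⬝ᵥ v)⁻¹ • v := by
  rw [dual, star_smul, star_star, star_inv₀, ← star_dotProduct]

lemma isHyperbolicPair_dual {v : n → ℂ} (hv : v ≠ 0) (h : v ⬝ᵥ v = 0) :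
    IsHyperbolicPair v (dual v) where
  dotProduct_self_left := h
  dotProduct_self_right := by simp [dual, star_dotProduct_star, h]
  dotProduct_eq_one := by
    rw [dual, dotProduct_smul, dotProduct_comm v, smul_eq_mul,
      inv_mul_cancel₀ (star_dotProduct_self_ne_zero hv)]

variable {l k : n → ℂ}

lemma star_dotProduct_eq_zero_iff (hl : l ≠ 0) {x : n → ℂ} :
    star l ⬝ᵥ x = 0 ↔ dual l ⬝ᵥ x = 0 := by
  rw [star_eq_smul_dual hl, smul_dotProduct, smul_eq_mul, mul_eq_zero,
    or_iff_right (star_dotProduct_self_ne_zero hl)]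

lemma dual_dotProduct_eq_zero_comm (hl : l ≠ 0) (hk : k ≠ 0) :
    dual l ⬝ᵥ k = 0 ↔ dual k ⬝ᵥ l = 0 := by
  rw [← star_dotProduct_eq_zero_iff hl, ← star_dotProduct_eq_zero_iff hk, star_dotProduct,
    star_eq_zero, dotProduct_comm]

lemma dual_dotProduct_dual (h : l ⬝ᵥ k = 0) : dual l ⬝ᵥ dual k = 0 := by
  rw [dual, dual, smul_dotProduct, dotProduct_smul, star_dotProduct_star, dotProduct_comm k, h,
    star_zero, smul_zero, smul_zero]

end Dual

section Mobius

lemma mobius_eq_div (a b : ℂ) :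
    mobius a b =
      algebraMap ℂ[X] (RatFunc ℂ) (X - C a) / algebraMap ℂ[X] (RatFunc ℂ) (X - C b) := by
  simp [mobius]

lemma ratFunc_X_sub_C_ne_zero (a : ℂ) : (RatFunc.X - RatFunc.C a : RatFunc ℂ) ≠ 0 := by
  simpa [← RatFunc.algebraMap_X, ← RatFunc.algebraMap_C, ← map_sub] using
    (X_sub_C_ne_zero a)

lemma mobius_mul_mobius (a b : ℂ) : mobius a b * mobius b a = 1 := by
  rw [mobius, mobius, div_mul_div_cancel₀ (ratFunc_X_sub_C_ne_zero b),
    div_self (ratFunc_X_sub_C_ne_zero a)]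

lemma mobius_mem_regularAt (a : ℂ) {b z : ℂ} (h : z ≠ b) : mobius a b ∈ regularAt z := by
  rw [mobius_eq_div]
  exact div_mem_regularAt _ (by simpa [sub_eq_zero] using h)

lemma mapCoeff_mobius (φ : ℂ →+* ℂ) (a b : ℂ) :
    mapCoeff φ (mobius a b) = mobius (φ a) (φ b) := by
  simp [mobius, mapCoeff_X, mapCoeff_C]

lemma exists_eq_mobius_mul {a : ℂ} (b : ℂ) {f : regularAt a} (h : valueAt a f = 0) :
    ∃ g ∈ regularAt a, (f : RatFunc ℂ) = mobius a b * g := by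
  obtain ⟨g, hg, hfg⟩ := exists_eq_X_sub_C_mul h
  refine ⟨(RatFunc.X - RatFunc.C b) * g, mul_mem ?_ hg, ?_⟩
  · rw [← RatFunc.algebraMap_X, ← RatFunc.algebraMap_C, ← map_sub]
    exact algebraMap_mem_regularAt _ a
  · rw [hfg, mobius, ← mul_assoc, div_mul_cancel₀ _ (ratFunc_X_sub_C_ne_zero b)]

lemma C_mem_regularAtInfty (c : ℂ) : RatFunc.C c ∈ regularAtInfty ℂ := by
  classical
  obtain rfl | hc := eq_or_ne c 0
  · simp
  · exact (RatFunc.inftyValuation.C ℂ hc).le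

/-- The constants, as rational functions without a pole at infinity. -/
def constInfty : ℂ →+* regularAtInfty ℂ :=
  RatFunc.C.codRestrict (regularAtInfty ℂ).toSubring C_mem_regularAtInfty

lemma exists_residue_mobius_eq_one (a b : ℂ) :
    ∃ f : regularAtInfty ℂ, (f : RatFunc ℂ) = mobius a b ∧ IsLocalRing.residue _ f = 1 := by
  classical
  have hdiff : mobius a b - 1 = RatFunc.C (b - a) * (RatFunc.X - RatFunc.C b)⁻¹ := by
    rw [mobius, div_sub_one (ratFunc_X_sub_C_ne_zero b), map_sub]
    ring
  have hval : RatFunc.inftyValuation ℂ (RatFunc.X - RatFunc.C b)⁻¹ < 1 := by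
    rw [map_inv₀, ← RatFunc.algebraMap_X, ← RatFunc.algebraMap_C, ← map_sub,
      RatFunc.inftyValuation_apply, RatFunc.inftyValuation.polynomial ℂ (X_sub_C_ne_zero b),
      natDegree_X_sub_C, ← WithZero.exp_neg, ← WithZero.exp_zero, WithZero.exp_lt_exp]
    omega
  let f : regularAtInfty ℂ := constInfty (b - a) * ⟨_, hval.le⟩
  refine ⟨f + 1, eq_add_of_sub_eq hdiff |>.symm, ?_⟩
  have hf : IsLocalRing.residue _ f = 0 := by
    rw [IsLocalRing.residue_eq_zero_iff]
    exact Ideal.mul_mem_left _ _ ((Valuation.mem_maximalIdeal_iff _ _).2 hval)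
  rw [map_add, hf, map_one, zero_add]

end Mobius

section NormalizedLoop

variable {n : Type*} [Fintype n] [DecidableEq n]

/-- A rational loop `g` that is orthogonal, satisfies the reality condition `g(λ̄) = conj (g(λ))`,
takes the value `1` at infinity and has all its poles in `P`. The value at infinity is the residue
of a matrix over the local ring at infinity. -/
structure IsNormalizedLoop (P : Set ℂ) (g : Matrix n n (RatFunc ℂ)) : Prop where
  transpose_mul_self : gᵀ * g = 1
  map_conj : g.map (mapCoeff conj) = g
  exists_residue_eq_one : ∃ H : Matrix n n (regularAtInfty ℂ),
    H.map (regularAtInfty ℂ).subtype = g ∧ H.map (IsLocalRing.residue _) = 1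
  mem_regularAt : ∀ z ∉ P, g ∈ (regularAt z).matrix

namespace IsNormalizedLoop

variable {P Q : Set ℂ} {g h : Matrix n n (RatFunc ℂ)}

lemma mul_transpose_self (hg : IsNormalizedLoop P g) : g * gᵀ = 1 :=
  mul_eq_one_comm.1 hg.transpose_mul_self

lemma mul (hg : IsNormalizedLoop P g) (hh : IsNormalizedLoop Q h) :
    IsNormalizedLoop (P ∪ Q) (g * h) where
  transpose_mul_self := by
    rw [transpose_mul, Matrix.mul_assoc, ← Matrix.mul_assoc gᵀ, hg.transpose_mul_self,
      Matrix.one_mul, hh.transpose_mul_self]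
  map_conj := by rw [Matrix.map_mul, hg.map_conj, hh.map_conj]
  exists_residue_eq_one := by
    obtain ⟨G, rfl, hG⟩ := hg.exists_residue_eq_one
    obtain ⟨H, rfl, hH⟩ := hh.exists_residue_eq_one
    exact ⟨G * H, Matrix.map_mul, by rw [Matrix.map_mul, hG, hH, Matrix.one_mul]⟩
  mem_regularAt z hz :=
    mul_mem (hg.mem_regularAt z fun h => hz (.inl h)) (hh.mem_regularAt z fun h => hz (.inr h))

lemma transpose (hg : IsNormalizedLoop P g) : IsNormalizedLoop P gᵀ where
  transpose_mul_self := hg.mul_transpose_self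
  map_conj := by rw [transpose_map, hg.map_conj]
  exists_residue_eq_one := by
    obtain ⟨G, rfl, hG⟩ := hg.exists_residue_eq_one
    exact ⟨Gᵀ, rfl, by rw [transpose_map, hG, transpose_one]⟩
  mem_regularAt z hz := transpose_mem (hg.mem_regularAt z hz)

lemma of_mem_regularAt (hg : IsNormalizedLoop (P ∪ Q) g)
    (h : ∀ z ∈ Q, g ∈ (regularAt z).matrix) : IsNormalizedLoop P g :=
  { hg with
    mem_regularAt z hz := by
      by_cases hQ : z ∈ Q
      · exact h z hQ
      · exact hg.mem_regularAt z (by simp [hz, hQ]) }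

lemma mem_regularAt_conj (hg : IsNormalizedLoop P g) {z : ℂ} (h : g ∈ (regularAt z).matrix) :
    g ∈ (regularAt (conj z)).matrix := fun i j => by
  rw [← hg.map_conj]
  exact mapCoeff_mem_regularAt _ (h i j)

lemma eq_one (hP : IsNormalizedLoop P g) (hQ : IsNormalizedLoop Q g) (hPQ : Disjoint P Q) :
    g = 1 := by
  have hreg (z : ℂ) : g ∈ (regularAt z).matrix := by
    by_cases hz : z ∈ P
    · exact hQ.mem_regularAt z (hPQ.notMem_of_mem_left hz)
    · exact hP.mem_regularAt z hz
  obtain ⟨G, rfl, hG⟩ := hP.exists_residue_eq_one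
  have hG1 : G - 1 = 0 := by
    ext1 i j
    refine eq_zero_of_forall_mem_regularAt (fun z => ?_) ?_
    · simpa [one_apply, apply_ite] using sub_mem (hreg z) (one_mem _) i j
    · exact congrFun₂ (show (G - 1).map (IsLocalRing.residue _) = 0 by
        rw [Matrix.map_sub _ (map_sub _), hG, Matrix.map_one _ (map_zero _) (map_one _),
          sub_self]) i j
  rw [sub_eq_zero.1 hG1, Matrix.map_one _ (map_zero _) (map_one _)]

end IsNormalizedLoop

/-- The loop that multiplies `v` by `(λ - α)/(λ - ᾱ)` and its conjugate by the inverse; it is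
`simpleLoop` in terms of a vector that spans the line. -/
def isotropicLoop (α : ℂ) (v : n → ℂ) : Matrix n n (RatFunc ℂ) :=
  scaling (mobius α (conj α)) (mobius (conj α) α) (RatFunc.C ∘ v) (RatFunc.C ∘ dual v)

lemma isNormalizedLoop_isotropicLoop (α : ℂ) {v : n → ℂ} (hv : v ≠ 0) (h : v ⬝ᵥ v = 0) :
    IsNormalizedLoop {α, conj α} (isotropicLoop α v) where
  transpose_mul_self := by
    rw [isotropicLoop, transpose_scaling,
      scaling_mul_scaling ((isHyperbolicPair_dual hv h).map RatFunc.C), mobius_mul_mobius,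
      mobius_mul_mobius, scaling_one_one]
  map_conj := by
    have hleft : mapCoeff conj ∘ RatFunc.C ∘ v =
        RatFunc.C (star v ⬝ᵥ v) • (RatFunc.C ∘ dual v) := by
      ext i
      simpa [mapCoeff_C] using congrArg RatFunc.C (congrFun (star_eq_smul_dual hv) i)
    have hright : mapCoeff conj ∘ RatFunc.C ∘ dual v =
        RatFunc.C (star v ⬝ᵥ v)⁻¹ • (RatFunc.C ∘ v) := by
      ext i
      simpa [mapCoeff_C] using congrArg RatFunc.C (congrFun (star_dual v) i)
    rw [isotropicLoop, scaling_map, mapCoeff_mobius, mapCoeff_mobius, Complex.conj_conj, hleft,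
      hright, scaling_smul_smul, scaling_swap]
    rw [← map_mul, mul_inv_cancel₀ (star_dotProduct_self_ne_zero hv), map_one]
  exists_residue_eq_one := by
    obtain ⟨s, hs, hs1⟩ := exists_residue_mobius_eq_one α (conj α)
    obtain ⟨t, ht, ht1⟩ := exists_residue_mobius_eq_one (conj α) α
    refine ⟨scaling s t (constInfty ∘ v) (constInfty ∘ dual v), ?_, ?_⟩
    · rw [isotropicLoop, ← hs, ← ht, scaling_map]
      rfl
    · rw [scaling_map, hs1, ht1, scaling_one_one]
  mem_regularAt z hz := by
    simp only [Set.mem_insert_iff, Set.mem_singleton_iff, not_or] at hz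
    exact scaling_mem (mobius_mem_regularAt _ hz.2) (mobius_mem_regularAt _ hz.1)
      (fun i => C_mem_regularAt _ z) (fun i => C_mem_regularAt _ z)

end NormalizedLoop

section Evaluation

variable {F n : Type*} [Field F] [Fintype n] [DecidableEq n] {a : F}
  {g h : Matrix n n (RatFunc F)}

lemma exists_map_valueAt_eq (hg : g ∈ (regularAt a).matrix) :
    ∃ G : Matrix n n (regularAt a), G.map (regularAt a).subtype = g ∧
      G.map (valueAt a) = g.map (RatFunc.eval (RingHom.id F) a) :=
  ⟨of fun i j => ⟨g i j, hg i j⟩, rfl, rfl⟩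

lemma eval_mul_of_mem_regularAt (hg : g ∈ (regularAt a).matrix) (hh : h ∈ (regularAt a).matrix) :
    (g * h).map (RatFunc.eval (RingHom.id F) a) =
      g.map (RatFunc.eval (RingHom.id F) a) * h.map (RatFunc.eval (RingHom.id F) a) := by
  obtain ⟨G, rfl, hG⟩ := exists_map_valueAt_eq hg
  obtain ⟨H, rfl, hH⟩ := exists_map_valueAt_eq hh
  rw [← hG, ← hH, ← Matrix.map_mul, ← Matrix.map_mul]
  rfl

lemma eval_transpose_mul_self (hg : g ∈ (regularAt a).matrix) (horth : gᵀ * g = 1) :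
    (g.map (RatFunc.eval (RingHom.id F) a))ᵀ * g.map (RatFunc.eval (RingHom.id F) a) = 1 := by
  rw [← transpose_map, ← eval_mul_of_mem_regularAt (transpose_mem hg) hg, horth,
    Matrix.map_one _ (RatFunc.eval_zero _ _) (RatFunc.eval_one _ _)]

end Evaluation

section LoopDressing

variable {n : Type*} [Fintype n] [DecidableEq n] {α : ℂ} {h : Matrix n n (RatFunc ℂ)} {v : n → ℂ}

lemma ne_zero_of_transpose_mul_self_eq_one {A : Matrix n n ℂ} (hA : Aᵀ * A = 1) (hv : v ≠ 0) :
    A *ᵥ v ≠ 0 := fun h0 => hv <| by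
  rw [← one_mulVec v, ← hA, ← mulVec_mulVec, h0, mulVec_zero]

lemma mulVec_dotProduct_mulVec {A : Matrix n n ℂ} (hA : Aᵀ * A = 1) (v w : n → ℂ) :
    (A *ᵥ v) ⬝ᵥ (A *ᵥ w) = v ⬝ᵥ w := by
  rw [dotProduct_mulVec, vecMul_mulVec, hA, vecMul_one]

lemma exists_mulVec_eq_add_mobius_smul (b : ℂ) (hh : h ∈ (regularAt α).matrix) :
    ∃ z : n → RatFunc ℂ, (∀ i, z i ∈ regularAt α) ∧ h *ᵥ (RatFunc.C ∘ v) =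
      RatFunc.C ∘ (h.map (RatFunc.eval (RingHom.id ℂ) α) *ᵥ v) + mobius α b • z := by
  obtain ⟨H, rfl, hH⟩ := exists_map_valueAt_eq hh
  let v₀ : n → regularAt α := constAt α ∘ v
  let d : n → regularAt α := H *ᵥ v₀ - constAt α ∘ (H.map (valueAt α) *ᵥ v)
  have hd (i : n) : valueAt α (d i) = 0 := by
    have hv₀ : valueAt α ∘ v₀ = v := funext fun j => valueAt_constAt α (v j)
    rw [show d i = (H *ᵥ v₀) i - constAt α ((H.map (valueAt α) *ᵥ v) i) from rfl, map_sub,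
      RingHom.map_mulVec, hv₀, valueAt_constAt, sub_self]
  choose z hz hdz using fun i => exists_eq_mobius_mul b (hd i)
  refine ⟨z, hz, funext fun i => eq_add_of_sub_eq' ?_⟩
  rw [← hH, Pi.smul_apply, smul_eq_mul, ← hdz i, ← Subring.subtype_apply]
  simp only [d, Pi.sub_apply, map_sub, RingHom.map_mulVec]
  rfl

lemma isotropicLoop_mul_mul_mem_regularAt (hα : α ≠ conj α) (horth : hᵀ * h = 1)
    (hh : h ∈ (regularAt α).matrix) (hv : v ≠ 0) (hvv : v ⬝ᵥ v = 0) :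
    isotropicLoop α (h.map (RatFunc.eval (RingHom.id ℂ) α) *ᵥ v) * h * (isotropicLoop α v)ᵀ ∈
      (regularAt α).matrix := by
  obtain ⟨z, hz, hhz⟩ := exists_mulVec_eq_add_mobius_smul (v := v) (conj α) hh
  have hvalue := eval_transpose_mul_self hh horth
  have h2 : (2 : RatFunc ℂ)⁻¹ = RatFunc.C 2⁻¹ := by rw [map_inv₀, map_ofNat]
  rw [isotropicLoop, isotropicLoop, transpose_scaling]
  refine scaling_mul_mul_scaling_mem (mobius_mul_mobius _ _) (mobius_mem_regularAt _ hα)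
    two_ne_zero (h2 ▸ C_mem_regularAt _ _) horth hh ?_ ?_ ?_ ?_ ?_ ?_ hz hhz
  · exact (isHyperbolicPair_dual hv hvv).map _
  · exact (isHyperbolicPair_dual (ne_zero_of_transpose_mul_self_eq_one hvalue hv)
      (by rw [mulVec_dotProduct_mulVec hvalue, hvv])).map _
  all_goals exact fun i => C_mem_regularAt _ _

lemma IsNormalizedLoop.isotropicLoop_mul_mul {P : Set ℂ} (hα : α ≠ conj α)
    (hh : IsNormalizedLoop P h) (hαP : α ∉ P) (hv : v ≠ 0) (hvv : v ⬝ᵥ v = 0) :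
    IsNormalizedLoop P (isotropicLoop α (h.map (RatFunc.eval (RingHom.id ℂ) α) *ᵥ v) * h *
      (isotropicLoop α v)ᵀ) := by
  have hmem := hh.mem_regularAt α hαP
  have hvalue := eval_transpose_mul_self hmem hh.transpose_mul_self
  have hleft := isNormalizedLoop_isotropicLoop α
    (ne_zero_of_transpose_mul_self_eq_one hvalue hv)
    (by rw [mulVec_dotProduct_mulVec hvalue, hvv])
  have hprod := (hleft.mul hh).mul (isNormalizedLoop_isotropicLoop α hv hvv).transpose
  rw [Set.union_comm _ P, Set.union_assoc, Set.union_self] at hprod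
  have hreg := isotropicLoop_mul_mul_mem_regularAt hα hh.transpose_mul_self hmem hv hvv
  refine hprod.of_mem_regularAt ?_
  rintro z (rfl | rfl)
  · exact hreg
  · exact hprod.mem_regularAt_conj hreg

end LoopDressing

section Line

/-- The line in `ℂ⁷` that is spanned by the vector with coordinates `v`. -/
def line (v : Fin 7 → ℂ) : Submodule ℂ V := ℂ ∙ WithLp.toLp 2 v

lemma bil_toLp (v w : Fin 7 → ℂ) : bil (WithLp.toLp 2 v) (WithLp.toLp 2 w) = v ⬝ᵥ w := rfl

lemma bil_smul_smul (a b : ℂ) (x y : V) : bil (a • x) (b • y) = a * b * bil x y := by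
  simp only [bil, PiLp.smul_apply, smul_eq_mul, Finset.mul_sum]
  exact Finset.sum_congr rfl fun i _ => by ring

lemma isIsotropic_line_iff {v : Fin 7 → ℂ} : IsIsotropic (line v) ↔ v ⬝ᵥ v = 0 := by
  constructor
  · exact fun h => h _ (Submodule.mem_span_singleton_self _) _ (Submodule.mem_span_singleton_self _)
  · intro h x hx y hy
    obtain ⟨a, rfl⟩ := Submodule.mem_span_singleton.1 hx
    obtain ⟨b, rfl⟩ := Submodule.mem_span_singleton.1 hy
    rw [bil_smul_smul, bil_toLp, h, mul_zero]

lemma isIsotropicLine_line {v : Fin 7 → ℂ} (hv : v ≠ 0) (h : v ⬝ᵥ v = 0) :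
    IsIsotropicLine (line v) :=
  ⟨finrank_span_singleton (by simpa using hv), isIsotropic_line_iff.2 h⟩

lemma IsIsotropicLine.exists_eq_line {L : Submodule ℂ V} (hL : IsIsotropicLine L) :
    ∃ v : Fin 7 → ℂ, v ≠ 0 ∧ v ⬝ᵥ v = 0 ∧ L = line v := by
  obtain ⟨x, hx, hspan⟩ := finrank_eq_one_iff'.1 hL.1
  have hLx : L = line (x : V).ofLp := by
    refine le_antisymm (fun y hy => ?_) ((Submodule.span_singleton_le_iff_mem _ _).2 x.2)
    obtain ⟨c, hc⟩ := hspan ⟨y, hy⟩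
    exact Submodule.mem_span_singleton.2 ⟨c, congrArg Subtype.val hc⟩
  exact ⟨_, by simpa using hx, isIsotropic_line_iff.1 (hLx ▸ hL.2), hLx⟩

lemma image_line (A : Matrix (Fin 7) (Fin 7) ℂ) (v : Fin 7 → ℂ) :
    image A (line v) = line (A *ᵥ v) := by
  rw [image, line, Submodule.map_span, Set.image_singleton, toLpLin_toLp]
  rfl

lemma conjSub_line (v : Fin 7 → ℂ) : conjSub (line v) = line (star v) := by
  rw [conjSub, line, Submodule.map_span, Set.image_singleton]
  rfl

lemma projMat_mulVec (W : Submodule ℂ V) (x : Fin 7 → ℂ) :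
    projMat W *ᵥ x = (W.starProjection (WithLp.toLp 2 x)).ofLp := by
  rw [← Matrix.ofLp_toEuclideanCLM (𝕜 := ℂ), projMat]
  simp

lemma inner_toLp (v w : Fin 7 → ℂ) :
    inner ℂ (WithLp.toLp 2 v) (WithLp.toLp 2 w) = star v ⬝ᵥ w := by
  rw [EuclideanSpace.inner_toLp_toLp, dotProduct_comm]

lemma projMat_line (v : Fin 7 → ℂ) : projMat (line v) = vecMulVec v (dual v) := by
  refine ext_of_mulVec_single fun i => ?_
  rw [projMat_mulVec, line, Submodule.starProjection_singleton, RCLike.ofReal_pow,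
    ← inner_self_eq_norm_sq_to_K, inner_toLp, inner_toLp, vecMulVec_mulVec, op_smul_eq_smul, dual,
    smul_dotProduct, smul_eq_mul, ← div_eq_inv_mul, WithLp.ofLp_smul]

lemma projMat_conjSub_line (v : Fin 7 → ℂ) :
    projMat (conjSub (line v)) = vecMulVec (dual v) v := by
  rw [conjSub_line, projMat_line, dual, dual, star_star, smul_vecMulVec, vecMulVec_smul,
    dotProduct_comm]

lemma perp_conjSub (W : Submodule ℂ V) : perp (conjSub W) = Wᗮ := by
  ext x
  exact ⟨fun h w hw => h _ (Submodule.mem_map_of_mem hw), fun h => by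
    rintro _ ⟨w, hw, rfl⟩; exact h w hw⟩

lemma perp_line_sup_conjSub (v : Fin 7 → ℂ) :
    perp (line v ⊔ conjSub (line v)) = (line v ⊔ line (star v))ᗮ := by
  rw [← perp_conjSub, conjSub, conjSub, Submodule.map_sup, ← conjSub, ← conjSub, conjSub_line,
    conjSub_line, star_star, sup_comm]

lemma projMat_perp_line {v : Fin 7 → ℂ} (hv : v ≠ 0) (h : v ⬝ᵥ v = 0) :
    projMat (perp (line v ⊔ conjSub (line v))) = scaling 0 0 v (dual v) := by
  refine ext_of_mulVec_single fun i => ?_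
  set x : Fin 7 → ℂ := Pi.single i 1
  have hpair := isHyperbolicPair_dual hv h
  rw [projMat_mulVec, perp_line_sup_conjSub, Submodule.starProjection_orthogonal_val,
    Submodule.eq_starProjection_of_mem_orthogonal
      (v := WithLp.toLp 2 ((dual v ⬝ᵥ x) • v + (v ⬝ᵥ x) • dual v)), scaling_mulVec]
  · simp only [WithLp.ofLp_sub]
    module
  · refine Submodule.add_mem_sup ?_ ?_
    · exact Submodule.smul_mem _ _ (Submodule.mem_span_singleton_self _)
    · exact Submodule.smul_mem _ _ (Submodule.smul_mem _ _ (Submodule.mem_span_singleton_self _))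
  · rw [← Submodule.inf_orthogonal, line, line, Submodule.mem_inf,
      Submodule.mem_orthogonal_singleton_iff_inner_right,
      Submodule.mem_orthogonal_singleton_iff_inner_right, ← WithLp.toLp_sub, inner_toLp, inner_toLp,
      star_star, star_eq_smul_dual hv, smul_dotProduct]
    simp [dotProduct_sub, hpair.dotProduct_self_left, hpair.dotProduct_self_right,
      hpair.dotProduct_eq_one, hpair.dotProduct_eq_one']

lemma simpleLoop_line (α : ℂ) {v : Fin 7 → ℂ} (hv : v ≠ 0) (h : v ⬝ᵥ v = 0) :
    simpleLoop α (line v) = isotropicLoop α v := by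
  rw [simpleLoop, projMat_line, projMat_conjSub_line v, projMat_perp_line hv h]
  ext i j
  simp [constLoop, scaling, vecMulVec_apply, isotropicLoop, apply_ite, one_apply]
  ring

end Line

section Holomorphic

variable {P : Set ℂ} {α : ℂ} {h : Loop} {v : Fin 7 → ℂ}

lemma isotropicLoop_inv (α : ℂ) {v : Fin 7 → ℂ} (hv : v ≠ 0) (hvv : v ⬝ᵥ v = 0) :
    (isotropicLoop α v)⁻¹ = (isotropicLoop α v)ᵀ :=
  inv_eq_left_inv (isNormalizedLoop_isotropicLoop α hv hvv).transpose_mul_self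

lemma IsNormalizedLoop.transpose_evalAt_mul_evalAt (hh : IsNormalizedLoop P h) (hα : α ∉ P) :
    (evalAt h α)ᵀ * evalAt h α = 1 :=
  eval_transpose_mul_self (hh.mem_regularAt α hα) hh.transpose_mul_self

lemma IsNormalizedLoop.isHolomorphicAt (hh : IsNormalizedLoop P h) (hα : α ∉ P) :
    IsHolomorphicAt h α :=
  ⟨fun i j => hh.mem_regularAt α hα i j,
    IsUnit.of_mul_eq_one_right _ (hh.transpose_evalAt_mul_evalAt hα)⟩

lemma IsNormalizedLoop.dress_image_line (hh : IsNormalizedLoop P h) (hα : α ∉ P) (hv : v ≠ 0)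
    (hvv : v ⬝ᵥ v = 0) :
    dress α (image (evalAt h α) (line v)) h =
      isotropicLoop α (evalAt h α *ᵥ v) * h * (isotropicLoop α v)ᵀ := by
  have horth := hh.transpose_evalAt_mul_evalAt hα
  rw [dress, image_line, image_line, mulVec_mulVec, inv_eq_left_inv horth, horth, one_mulVec,
    simpleLoop_line α hv hvv, isotropicLoop_inv α hv hvv,
    simpleLoop_line α (ne_zero_of_transpose_mul_self_eq_one horth hv)
      (by rw [mulVec_dotProduct_mulVec horth, hvv])]

end Holomorphic

section Cross

variable {R : Type*} [CommRing R]

/-- The product `octProd` in coordinates, as a bilinear map over an arbitrary commutative ring. -/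
def cross : (Fin 7 → R) →ₗ[R] (Fin 7 → R) →ₗ[R] (Fin 7 → R) :=
  LinearMap.mk₂ R
    (fun x y =>
      ![-(x 1 * y 4 - x 4 * y 1) - (x 2 * y 5 - x 5 * y 2) - (x 3 * y 6 - x 6 * y 3),
        (x 0 * y 4 - x 4 * y 0) - (x 2 * y 6 - x 6 * y 2) + (x 3 * y 5 - x 5 * y 3),
        (x 0 * y 5 - x 5 * y 0) + (x 1 * y 6 - x 6 * y 1) - (x 3 * y 4 - x 4 * y 3),
        (x 0 * y 6 - x 6 * y 0) - (x 1 * y 5 - x 5 * y 1) + (x 2 * y 4 - x 4 * y 2),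
        -(x 0 * y 1 - x 1 * y 0) - (x 2 * y 3 - x 3 * y 2) + (x 5 * y 6 - x 6 * y 5),
        -(x 0 * y 2 - x 2 * y 0) + (x 1 * y 3 - x 3 * y 1) - (x 4 * y 6 - x 6 * y 4),
        -(x 0 * y 3 - x 3 * y 0) - (x 1 * y 2 - x 2 * y 1) + (x 4 * y 5 - x 5 * y 4)])
    (fun _ _ _ => by ext i; fin_cases i <;> simp <;> ring)
    (fun _ _ _ => by ext i; fin_cases i <;> simp <;> ring)
    (fun _ _ _ => by ext i; fin_cases i <;> simp <;> ring)
    (fun _ _ _ => by ext i; fin_cases i <;> simp <;> ring)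

lemma octProd_toLp (x y : Fin 7 → ℂ) :
    octProd (WithLp.toLp 2 x) (WithLp.toLp 2 y) = WithLp.toLp 2 (cross x y) := rfl

lemma cross_map {R' : Type*} [CommRing R'] (f : R →+* R') (x y : Fin 7 → R) :
    cross (f ∘ x) (f ∘ y) = f ∘ cross x y := by
  ext i
  fin_cases i <;> simp [cross]

lemma cross_self (x : Fin 7 → R) : cross x x = 0 := by
  ext i
  fin_cases i <;> simp [cross] <;> ring

lemma cross_swap (x y : Fin 7 → R) : cross x y = -cross y x := by
  ext i
  fin_cases i <;> simp [cross] <;> ring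

/-- The product of imaginary octonions transported along `A`. It equals `cross` when `A` is an
automorphism of the octonions, whose inverse is `Aᵀ`. -/
def transportCross (A : Matrix (Fin 7) (Fin 7) R) :
    (Fin 7 → R) →ₗ[R] (Fin 7 → R) →ₗ[R] (Fin 7 → R) :=
  (cross.compl₁₂ Aᵀ.mulVecLin Aᵀ.mulVecLin).compr₂ A.mulVecLin

lemma transportCross_apply (A : Matrix (Fin 7) (Fin 7) R) (x y : Fin 7 → R) :
    transportCross A x y = A *ᵥ cross (Aᵀ *ᵥ x) (Aᵀ *ᵥ y) := rfl

lemma transportCross_one : transportCross (1 : Matrix (Fin 7) (Fin 7) R) = cross := by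
  refine LinearMap.ext₂ fun x y => ?_
  rw [transportCross_apply, transpose_one, one_mulVec, one_mulVec, one_mulVec]

lemma transportCross_mul (A : Matrix (Fin 7) (Fin 7) R) {B : Matrix (Fin 7) (Fin 7) R}
    (hB : transportCross B = cross) : transportCross (A * B) = transportCross A := by
  refine LinearMap.ext₂ fun x y => ?_
  rw [transportCross_apply, transportCross_apply, transpose_mul, ← mulVec_mulVec,
    ← mulVec_mulVec, ← mulVec_mulVec, ← transportCross_apply B, hB]

lemma transportCross_map {R' : Type*} [CommRing R'] (f : R →+* R')
    (A : Matrix (Fin 7) (Fin 7) R) (x y : Fin 7 → R) :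
    transportCross (A.map f) (f ∘ x) (f ∘ y) = f ∘ transportCross A x y := by
  have hmulVec (B : Matrix (Fin 7) (Fin 7) R) (z : Fin 7 → R) :
      B.map f *ᵥ (f ∘ z) = f ∘ (B *ᵥ z) := funext fun i => (RingHom.map_mulVec f B z i).symm
  rw [transportCross_apply, transportCross_apply, ← transpose_map, hmulVec, hmulVec, cross_map,
    hmulVec]

lemma cross_mulVec_mulVec {A : Matrix (Fin 7) (Fin 7) R} (hA : Aᵀ * A = 1)
    (hcross : transportCross A = cross) (x y : Fin 7 → R) :
    cross (A *ᵥ x) (A *ᵥ y) = A *ᵥ cross x y := by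
  conv_lhs => rw [← hcross, transportCross_apply, mulVec_mulVec, mulVec_mulVec, hA, one_mulVec,
    one_mulVec]

lemma transportCross_eq_cross {A : Matrix (Fin 7) (Fin 7) R} (hA : A * Aᵀ = 1)
    (hcross : ∀ x y, cross (Aᵀ *ᵥ x) (Aᵀ *ᵥ y) = Aᵀ *ᵥ cross x y) : transportCross A = cross := by
  refine LinearMap.ext₂ fun x y => ?_
  rw [transportCross_apply, hcross, mulVec_mulVec, hA, one_mulVec]

lemma transportCross_transpose {A : Matrix (Fin 7) (Fin 7) R} (hA : Aᵀ * A = 1)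
    (hcross : transportCross A = cross) : transportCross Aᵀ = cross := by
  refine LinearMap.ext₂ fun x y => ?_
  rw [transportCross_apply, transpose_transpose, cross_mulVec_mulVec hA hcross, mulVec_mulVec, hA,
    one_mulVec]

end Cross

section Eichler

variable {R n : Type*} [CommRing R] [DecidableEq n]

/-- The Eichler transformation `x ↦ x + (v ⬝ᵥ x) u - (u ⬝ᵥ x) v` of two vectors `u` and `v`. It is
orthogonal if `u` and `v` span a totally isotropic subspace. -/
def eichler (u v : n → R) : Matrix n n R := 1 + vecMulVec u v - vecMulVec v u

lemma transpose_eichler (u v : n → R) : (eichler u v)ᵀ = eichler v u := by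
  simp only [eichler, transpose_sub, transpose_add, transpose_one, transpose_vecMulVec]

variable [Fintype n]

lemma eichler_mulVec (u v x : n → R) :
    eichler u v *ᵥ x = x + (v ⬝ᵥ x) • u - (u ⬝ᵥ x) • v := by
  simp [eichler, add_mulVec, sub_mulVec, vecMulVec_mulVec]

lemma eichler_mul_transpose {u v : n → R} (huu : u ⬝ᵥ u = 0) (huv : u ⬝ᵥ v = 0)
    (hvv : v ⬝ᵥ v = 0) : eichler u v * (eichler u v)ᵀ = 1 := by
  have hvu : v ⬝ᵥ u = 0 := dotProduct_comm v u ▸ huv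
  rw [transpose_eichler]
  refine ext_of_mulVec_single fun i => ?_
  simp only [← mulVec_mulVec, eichler_mulVec, dotProduct_add, dotProduct_sub, dotProduct_smul, huu,
    huv, hvu, hvv, smul_zero, add_zero, sub_zero, one_mulVec]
  module

omit [DecidableEq n] in
lemma mul_vecMulVec_mul_transpose (A : Matrix n n R) (v w : n → R) :
    A * vecMulVec v w * Aᵀ = vecMulVec (A *ᵥ v) (A *ᵥ w) := by
  rw [mul_vecMulVec, vecMulVec_mul, vecMul_transpose]

lemma mul_eichler_mul_transpose {A : Matrix n n R} (hA : A * Aᵀ = 1) (u v : n → R) :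
    A * eichler u v * Aᵀ = eichler (A *ᵥ u) (A *ᵥ v) := by
  simp only [eichler, Matrix.mul_add, Matrix.mul_sub, Matrix.add_mul, Matrix.sub_mul,
    mul_vecMulVec_mul_transpose, Matrix.mul_one, hA]

lemma mul_scaling_mul_transpose {A : Matrix n n R} (hA : A * Aᵀ = 1) (s t : R) (v w : n → R) :
    A * scaling s t v w * Aᵀ = scaling s t (A *ᵥ v) (A *ᵥ w) := by
  simp only [scaling, Matrix.mul_add, Matrix.add_mul, Matrix.mul_smul, Matrix.smul_mul,
    mul_vecMulVec_mul_transpose, Matrix.mul_one, hA]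

end Eichler

section EichlerCross

lemma cross_cross_add_cross_cross {R : Type*} [CommRing R] (u v x : Fin 7 → R) :
    cross u (cross v x) + cross v (cross u x) =
      (u ⬝ᵥ x) • v + (v ⬝ᵥ x) • u - (2 * (u ⬝ᵥ v)) • x := by
  ext i
  fin_cases i <;> simp [cross, dotProduct, Fin.sum_univ_seven] <;> ring

lemma dotProduct_cross {R : Type*} [CommRing R] (u v x : Fin 7 → R) :
    u ⬝ᵥ cross v x = cross u v ⬝ᵥ x := by
  simp [cross, dotProduct, Fin.sum_univ_seven]
  ring

variable {F : Type*} [Field F] {u v : Fin 7 → F}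

lemma cross_cross_of_cross_eq_zero (huv : u ⬝ᵥ v = 0) (hcross : cross u v = 0) (x : Fin 7 → F) :
    cross v (cross u x) = (2 * (v ⬝ᵥ x)) • u - (u ⬝ᵥ x) • v := by
  have h := cross_cross_add_cross_cross v x u
  rw [cross_swap v u, hcross, neg_zero, map_zero, add_zero, cross_swap x u, map_neg,
    dotProduct_comm v u, huv, dotProduct_comm x u] at h
  rw [← neg_eq_iff_eq_neg.2 h.symm]
  module

lemma wedge_cross (h2 : (2 : F) ≠ 0) (huv : u ⬝ᵥ v = 0) (hcross : cross u v = 0)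
    (x y : Fin 7 → F) :
    (v ⬝ᵥ cross x y) • u - (u ⬝ᵥ cross x y) • v =
      cross ((v ⬝ᵥ x) • u - (u ⬝ᵥ x) • v) y + cross x ((v ⬝ᵥ y) • u - (u ⬝ᵥ y) • v) := by
  have hvu : cross v u = 0 := by rw [cross_swap, hcross, neg_zero]
  have hz := cross_cross_of_cross_eq_zero huv hcross (cross x y)
  have hy := cross_cross_of_cross_eq_zero huv hcross y
  have hux := congrArg (cross v) (cross_cross_add_cross_cross u x y)
  have hvx := cross_cross_add_cross_cross v x (cross u y)
  rw [map_add, hz, map_sub, map_add, map_smul, map_smul, map_smul, hvu] at hux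
  rw [hy, dotProduct_cross v u, hvu, zero_dotProduct, dotProduct_cross x u, cross_swap x u] at hvx
  rw [neg_dotProduct, ← dotProduct_cross] at hvx
  refine smul_right_injective _ h2 ?_
  simp only [map_sub, map_smul, LinearMap.sub_apply, LinearMap.smul_apply] at hvx ⊢
  rw [cross_swap v x] at hux
  linear_combination (norm := module) hux - hvx

lemma cross_eichler_mulVec (h2 : (2 : F) ≠ 0) (huv : u ⬝ᵥ v = 0) (hcross : cross u v = 0)
    (x y : Fin 7 → F) :
    cross (eichler u v *ᵥ x) (eichler u v *ᵥ y) = eichler u v *ᵥ cross x y := by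
  have hvu : cross v u = 0 := by rw [cross_swap, hcross, neg_zero]
  rw [eichler_mulVec, eichler_mulVec, eichler_mulVec, add_sub_assoc, add_sub_assoc, add_sub_assoc,
    wedge_cross h2 huv hcross]
  simp [cross_self, hcross, hvu]
  abel

lemma transportCross_eichler (h2 : (2 : F) ≠ 0) (huu : u ⬝ᵥ u = 0) (huv : u ⬝ᵥ v = 0)
    (hvv : v ⬝ᵥ v = 0) (hcross : cross u v = 0) : transportCross (eichler u v) = cross := by
  refine transportCross_eq_cross (eichler_mul_transpose huu huv hvv) fun x y => ?_
  rw [transpose_eichler]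
  exact cross_eichler_mulVec h2 (dotProduct_comm v u ▸ huv)
    (by rw [cross_swap, hcross, neg_zero]) x y

end EichlerCross

section CoassociativeFrame

/-- Two mutually orthogonal hyperbolic pairs `l`, `m` and `w`, `n` such that `l`, `w` and `m`, `n`
span coassociative planes. -/
structure IsCoassociativeFrame {R : Type*} [CommRing R] (l m w n : Fin 7 → R) : Prop where
  hyperbolic_left : IsHyperbolicPair l m
  hyperbolic_right : IsHyperbolicPair w n
  dotProduct_lw : l ⬝ᵥ w = 0
  dotProduct_ln : l ⬝ᵥ n = 0
  dotProduct_mw : m ⬝ᵥ w = 0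
  dotProduct_mn : m ⬝ᵥ n = 0
  cross_lw : cross l w = 0
  cross_mn : cross m n = 0

lemma IsCoassociativeFrame.map {R R' : Type*} [CommRing R] [CommRing R'] {l m w n : Fin 7 → R}
    (h : IsCoassociativeFrame l m w n) (f : R →+* R') :
    IsCoassociativeFrame (f ∘ l) (f ∘ m) (f ∘ w) (f ∘ n) where
  hyperbolic_left := h.hyperbolic_left.map f
  hyperbolic_right := h.hyperbolic_right.map f
  dotProduct_lw := by rw [← RingHom.map_dotProduct, h.dotProduct_lw, map_zero]
  dotProduct_ln := by rw [← RingHom.map_dotProduct, h.dotProduct_ln, map_zero]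
  dotProduct_mw := by rw [← RingHom.map_dotProduct, h.dotProduct_mw, map_zero]
  dotProduct_mn := by rw [← RingHom.map_dotProduct, h.dotProduct_mn, map_zero]
  cross_lw := by rw [cross_map, h.cross_lw]; exact funext fun _ => map_zero f
  cross_mn := by rw [cross_map, h.cross_mn]; exact funext fun _ => map_zero f

variable {F : Type*} [Field F] {l m w n : Fin 7 → F} {s t : F}

lemma IsCoassociativeFrame.smul (h : IsCoassociativeFrame l m w n) (hst : s * t = 1) :
    IsCoassociativeFrame (s • l) (t • m) w n where
  hyperbolic_left := by
    constructor <;>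
      simp [h.hyperbolic_left.dotProduct_self_left, h.hyperbolic_left.dotProduct_self_right,
        h.hyperbolic_left.dotProduct_eq_one, mul_comm t, hst]
  hyperbolic_right := h.hyperbolic_right
  dotProduct_lw := by rw [smul_dotProduct, h.dotProduct_lw, smul_zero]
  dotProduct_ln := by rw [smul_dotProduct, h.dotProduct_ln, smul_zero]
  dotProduct_mw := by rw [smul_dotProduct, h.dotProduct_mw, smul_zero]
  dotProduct_mn := by rw [smul_dotProduct, h.dotProduct_mn, smul_zero]
  cross_lw := by rw [map_smul, LinearMap.smul_apply, h.cross_lw, smul_zero]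
  cross_mn := by rw [map_smul, LinearMap.smul_apply, h.cross_mn, smul_zero]

/-- For a coassociative frame, an octonion automorphism that carries the hyperbolic pair `l`, `m` to
`b l + (1 - a b) n`, `a m + w`. -/
def frameIsometry (a b : F) (l m w n : Fin 7 → F) : Matrix (Fin 7) (Fin 7) F :=
  eichler ((a - 1) • m) n * eichler w l * eichler ((b - 1) • m) n

lemma mul_frameIsometry_mul_transpose {A : Matrix (Fin 7) (Fin 7) F} (hA : A * Aᵀ = 1) (a b : F)
    (l m w n : Fin 7 → F) :
    A * frameIsometry a b l m w n * Aᵀ =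
      frameIsometry a b (A *ᵥ l) (A *ᵥ m) (A *ᵥ w) (A *ᵥ n) := by
  have hA' : Aᵀ * A = 1 := mul_eq_one_comm.1 hA
  simp only [frameIsometry, ← mulVec_smul, ← mul_eichler_mul_transpose hA]
  simp only [Matrix.mul_assoc, ← Matrix.mul_assoc Aᵀ A, hA', Matrix.one_mul]

namespace IsCoassociativeFrame

variable (h : IsCoassociativeFrame l m w n) (a b : F)
include h

lemma frameIsometry_mulVec_left :
    frameIsometry a b l m w n *ᵥ l = b • l + (1 - a * b) • n := by
  simp only [frameIsometry, ← mulVec_mulVec, eichler_mulVec, dotProduct_add, dotProduct_sub,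
    dotProduct_smul, smul_dotProduct, h.hyperbolic_left.dotProduct_self_left,
    h.hyperbolic_left.dotProduct_eq_one', h.hyperbolic_right.dotProduct_self_right,
    h.hyperbolic_right.dotProduct_eq_one, h.hyperbolic_right.dotProduct_eq_one', h.dotProduct_ln,
    h.dotProduct_mw, h.dotProduct_mn, dotProduct_comm n l, dotProduct_comm w l, h.dotProduct_lw]
  module

lemma frameIsometry_mulVec_right : frameIsometry a b l m w n *ᵥ m = a • m + w := by
  simp only [frameIsometry, ← mulVec_mulVec, eichler_mulVec, dotProduct_add, dotProduct_sub,
    dotProduct_smul, smul_dotProduct, h.hyperbolic_left.dotProduct_self_right,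
    h.hyperbolic_left.dotProduct_eq_one, h.hyperbolic_right.dotProduct_eq_one',
    h.dotProduct_mw, dotProduct_comm n m, h.dotProduct_mn, dotProduct_comm w m]
  module

lemma eichler_smul_mul_transpose (c : F) : eichler (c • m) n * (eichler (c • m) n)ᵀ = 1 :=
  eichler_mul_transpose (by simp [h.hyperbolic_left.dotProduct_self_right])
    (by simp [h.dotProduct_mn]) h.hyperbolic_right.dotProduct_self_right

lemma frameIsometry_mul_transpose :
    frameIsometry a b l m w n * (frameIsometry a b l m w n)ᵀ = 1 := by
  have hmn (c : F) (B : Matrix (Fin 7) (Fin 7) F) :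
      eichler (c • m) n * ((eichler (c • m) n)ᵀ * B) = B := by
    rw [← Matrix.mul_assoc, h.eichler_smul_mul_transpose, Matrix.one_mul]
  have hwl (B : Matrix (Fin 7) (Fin 7) F) : eichler w l * ((eichler w l)ᵀ * B) = B := by
    rw [← Matrix.mul_assoc, eichler_mul_transpose h.hyperbolic_right.dotProduct_self_left
      (dotProduct_comm l w ▸ h.dotProduct_lw) h.hyperbolic_left.dotProduct_self_left,
      Matrix.one_mul]
  simp only [frameIsometry, transpose_mul, Matrix.mul_assoc, hmn, hwl,
    h.eichler_smul_mul_transpose]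

lemma transportCross_frameIsometry (h2 : (2 : F) ≠ 0) :
    transportCross (frameIsometry a b l m w n) = cross := by
  have hmn (c : F) : transportCross (eichler (c • m) n) = cross :=
    transportCross_eichler h2 (by simp [h.hyperbolic_left.dotProduct_self_right])
      (by simp [h.dotProduct_mn]) h.hyperbolic_right.dotProduct_self_right
      (by rw [map_smul, LinearMap.smul_apply, h.cross_mn, smul_zero])
  have hwl : transportCross (eichler w l) = cross :=
    transportCross_eichler h2 h.hyperbolic_right.dotProduct_self_left
      (dotProduct_comm l w ▸ h.dotProduct_lw) h.hyperbolic_left.dotProduct_self_left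
      (by rw [cross_swap, h.cross_lw, neg_zero])
  rw [frameIsometry, transportCross_mul _ (hmn _), transportCross_mul _ hwl, hmn]

/-- With `g = frameIsometry a b l m w n` and `σ = scaling s t l m`, the product is the commutator of
`σ` and `g`. The factors `σ g σᵀ` and `gᵀ` are octonion automorphisms, although `σ` is not. -/
lemma transportCross_scaling_mul_scaling (h2 : (2 : F) ≠ 0) (hst : s * t = 1) :
    transportCross (scaling s t l m * scaling s t (a • m + w) (b • l + (1 - a * b) • n)) =
      cross := by
  set g := frameIsometry a b l m w n with hg
  have hgg : g * gᵀ = 1 := h.frameIsometry_mul_transpose a b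
  have hσ : scaling s t l m * (scaling s t l m)ᵀ = 1 := by
    rw [transpose_scaling, scaling_mul_scaling h.hyperbolic_left, mul_comm t, hst, scaling_one_one]
  have hright : scaling s t (a • m + w) (b • l + (1 - a * b) • n) =
      g * (scaling s t l m)ᵀ * gᵀ := by
    rw [transpose_scaling, scaling_swap, mul_scaling_mul_transpose hgg, hg,
      h.frameIsometry_mulVec_left, h.frameIsometry_mulVec_right, scaling_swap]
  have hconj : scaling s t l m * g * (scaling s t l m)ᵀ =
      frameIsometry a b (s • l) (t • m) w n := by
    rw [mul_frameIsometry_mul_transpose hσ, scaling_mulVec_left h.hyperbolic_left,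
      scaling_mulVec_right h.hyperbolic_left, scaling_mulVec, scaling_mulVec, h.dotProduct_lw,
      h.dotProduct_mw, h.dotProduct_ln, h.dotProduct_mn]
    simp
  have hg' : transportCross gᵀ = cross := transportCross_transpose (mul_eq_one_comm.1 hgg)
    (h.transportCross_frameIsometry a b h2)
  rw [hright, ← Matrix.mul_assoc, ← Matrix.mul_assoc, hconj, transportCross_mul _ hg',
    (h.smul hst).transportCross_frameIsometry a b h2]

end IsCoassociativeFrame

end CoassociativeFrame


section PerpPart

variable {n : Type*} [Fintype n] [DecidableEq n] {l k : n → ℂ}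

/-- The projection of `x` to the orthogonal complement of `l` and its conjugate. -/
def perpPart (l x : n → ℂ) : n → ℂ := scaling 0 0 l (dual l) *ᵥ x

lemma perpPart_eq (l x : n → ℂ) :
    perpPart l x = x - (dual l ⬝ᵥ x) • l - (l ⬝ᵥ x) • dual l := by
  rw [perpPart, scaling_mulVec]
  module

lemma dotProduct_perpPart (hl : l ≠ 0) (hll : l ⬝ᵥ l = 0) (x : n → ℂ) :
    l ⬝ᵥ perpPart l x = 0 := by
  simp [perpPart_eq, hll, (isHyperbolicPair_dual hl hll).dotProduct_eq_one]

lemma dual_dotProduct_perpPart (hl : l ≠ 0) (hll : l ⬝ᵥ l = 0) (x : n → ℂ) :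
    dual l ⬝ᵥ perpPart l x = 0 := by
  simp [perpPart_eq, (isHyperbolicPair_dual hl hll).dotProduct_eq_one',
    (isHyperbolicPair_dual hl hll).dotProduct_self_right]

lemma star_perpPart (hl : l ≠ 0) (x : n → ℂ) : star (perpPart l x) = perpPart l (star x) := by
  have hconj : (scaling 0 0 l (dual l)).map conj = scaling 0 0 l (dual l) := by
    have hleft : conj ∘ l = (star l ⬝ᵥ l) • dual l := star_eq_smul_dual hl
    have hright : conj ∘ dual l = (star l ⬝ᵥ l)⁻¹ • l := star_dual l
    rw [scaling_map, map_zero, hleft, hright,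
      scaling_smul_smul (mul_inv_cancel₀ (star_dotProduct_self_ne_zero hl)), scaling_swap]
  ext i
  nth_rw 2 [perpPart]
  rw [← hconj]
  exact RingHom.map_mulVec conj (scaling 0 0 l (dual l)) x i

lemma perpPart_dual (hl : l ≠ 0) (k : n → ℂ) :
    perpPart l (dual k) = (star k ⬝ᵥ k)⁻¹ • star (perpPart l k) := by
  rw [star_perpPart hl, dual, perpPart, perpPart, mulVec_smul]

section Orthogonal

variable (hlk : dual l ⬝ᵥ k = 0)
include hlk

lemma eq_smul_dual_add_perpPart : k = (l ⬝ᵥ k) • dual l + perpPart l k := by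
  rw [perpPart_eq, hlk]
  module

lemma perpPart_dotProduct_self (hl : l ≠ 0) (hll : l ⬝ᵥ l = 0) (hkk : k ⬝ᵥ k = 0) :
    perpPart l k ⬝ᵥ perpPart l k = 0 := by
  nth_rw 2 [perpPart_eq]
  rw [hlk, dotProduct_sub, dotProduct_sub, dotProduct_smul, dotProduct_smul,
    dotProduct_comm _ (dual l), dual_dotProduct_perpPart hl hll, perpPart_eq, sub_dotProduct,
    sub_dotProduct, hkk, smul_dotProduct, smul_dotProduct, hlk]
  simp

lemma perpPart_eq_zero_symm (hk : k ≠ 0) (hkk : k ⬝ᵥ k = 0)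
    (h : perpPart l k = 0) : perpPart k l = 0 := by
  have hkl : star k = (star (l ⬝ᵥ k) * (star l ⬝ᵥ l)⁻¹) • l := by
    nth_rw 1 [eq_smul_dual_add_perpPart hlk]
    rw [h, add_zero, star_smul, star_dual, smul_smul]
  rw [star_eq_smul_dual hk] at hkl
  have hzero := congrArg (perpPart k) hkl
  simp only [perpPart, mulVec_smul, scaling_mulVec_right (isHyperbolicPair_dual hk hkk), zero_smul,
    smul_zero] at hzero
  refine (smul_eq_zero.1 hzero.symm).resolve_left fun hc => ?_
  rw [hc, zero_smul] at hkl
  exact smul_ne_zero (star_dotProduct_self_ne_zero hk) (dual_ne_zero hk) hkl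

lemma perpPart_eq_zero_iff_symm (hl : l ≠ 0) (hll : l ⬝ᵥ l = 0) (hk : k ≠ 0) (hkk : k ⬝ᵥ k = 0) :
    perpPart l k = 0 ↔ perpPart k l = 0 :=
  ⟨perpPart_eq_zero_symm hlk hk hkk,
    perpPart_eq_zero_symm ((dual_dotProduct_eq_zero_comm hl hk).1 hlk) hl hll⟩

lemma dual_eq_smul_add_dual_perpPart (hl : l ≠ 0) (hll : l ⬝ᵥ l = 0) (hk : k ≠ 0)
    (hkk : k ⬝ᵥ k = 0) (hw : perpPart l k ≠ 0) :
    dual k = (dual l ⬝ᵥ dual k) • l +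
      (1 - l ⬝ᵥ k * dual l ⬝ᵥ dual k) • dual (perpPart l k) := by
  set w := perpPart l k with hw_def
  have hlw : l ⬝ᵥ w = 0 := dotProduct_perpPart hl hll k
  have hl'w : dual l ⬝ᵥ dual w = 0 := dual_dotProduct_dual hlw
  obtain ⟨b, c, hdual⟩ : ∃ b c : ℂ, dual k = b • l + c • dual w := by
    refine ⟨(star k ⬝ᵥ k)⁻¹ * (star (l ⬝ᵥ k) * (star l ⬝ᵥ l)⁻¹),
      (star k ⬝ᵥ k)⁻¹ * (star w ⬝ᵥ w), ?_⟩
    rw [mul_smul, mul_smul, mul_smul, ← star_eq_smul_dual hw, ← star_dual, ← star_smul, ← smul_add,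
      ← star_add, hw_def, ← eq_smul_dual_add_perpPart hlk, dual]
  have hb : dual l ⬝ᵥ dual k = b := by
    rw [hdual, dotProduct_add, dotProduct_smul, dotProduct_smul, hl'w,
      (isHyperbolicPair_dual hl hll).dotProduct_eq_one', smul_zero, add_zero, smul_eq_mul, mul_one]
  have hwk : dual w ⬝ᵥ k = 1 := by
    rw [eq_smul_dual_add_perpPart hlk, dotProduct_add, dotProduct_smul, dotProduct_comm _ (dual l),
      hl'w, smul_zero, zero_add, ← hw_def]
    exact (isHyperbolicPair_dual hw
      (perpPart_dotProduct_self hlk hl hll hkk)).dotProduct_eq_one'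
  have hc : b * l ⬝ᵥ k + c = 1 := by
    have hpair := (isHyperbolicPair_dual hk hkk).dotProduct_eq_one'
    rwa [hdual, add_dotProduct, smul_dotProduct, smul_dotProduct, hwk, smul_eq_mul, smul_eq_mul,
      mul_one] at hpair
  rw [hb, mul_comm, ← eq_sub_of_add_eq' hc, hdual]

end Orthogonal

end PerpPart

section PairCriterion

variable {l k w : Fin 7 → ℂ}

lemma cross_star_star (x y : Fin 7 → ℂ) : cross (star x) (star y) = star (cross x y) :=
  cross_map conj x y

lemma cross_dual_dual (h : cross l w = 0) : cross (dual l) (dual w) = 0 := by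
  rw [dual, dual, map_smul, map_smul, LinearMap.smul_apply, cross_star_star, h, star_zero,
    smul_zero, smul_zero]

lemma isCoassociativeFrame_dual (hl : l ≠ 0) (hll : l ⬝ᵥ l = 0) (hw : w ≠ 0) (hww : w ⬝ᵥ w = 0)
    (hlw : l ⬝ᵥ w = 0) (hl'w : dual l ⬝ᵥ w = 0) (hcross : cross l w = 0) :
    IsCoassociativeFrame l (dual l) w (dual w) where
  hyperbolic_left := isHyperbolicPair_dual hl hll
  hyperbolic_right := isHyperbolicPair_dual hw hww
  dotProduct_lw := hlw
  dotProduct_ln := dotProduct_comm l _ ▸ (dual_dotProduct_eq_zero_comm hl hw).1 hl'w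
  dotProduct_mw := hl'w
  dotProduct_mn := dual_dotProduct_dual hlw
  cross_lw := hcross
  cross_mn := cross_dual_dual hcross

lemma transportCross_isotropicLoop_mul (α : ℂ) (hl : l ≠ 0) (hll : l ⬝ᵥ l = 0) (hk : k ≠ 0)
    (hkk : k ⬝ᵥ k = 0) (hlk : dual l ⬝ᵥ k = 0) (hw : perpPart l k ≠ 0)
    (hcross : cross l (perpPart l k) = 0) :
    transportCross (isotropicLoop α l * isotropicLoop α k) = cross := by
  have hframe := (isCoassociativeFrame_dual hl hll hw (perpPart_dotProduct_self hlk hl hll hkk)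
    (dotProduct_perpPart hl hll k) (dual_dotProduct_perpPart hl hll k) hcross).map RatFunc.C
  set a := l ⬝ᵥ k
  set b := dual l ⬝ᵥ dual k
  have hleft : RatFunc.C ∘ k =
      RatFunc.C a • (RatFunc.C ∘ dual l) + RatFunc.C ∘ perpPart l k := by
    ext i
    simpa using congrArg RatFunc.C (congrFun (eq_smul_dual_add_perpPart hlk) i)
  have hright : RatFunc.C ∘ dual k = RatFunc.C b • (RatFunc.C ∘ l) +
      (1 - RatFunc.C a * RatFunc.C b) • (RatFunc.C ∘ dual (perpPart l k)) := by
    ext i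
    simpa using congrArg RatFunc.C
      (congrFun (dual_eq_smul_add_dual_perpPart hlk hl hll hk hkk hw) i)
  rw [isotropicLoop, isotropicLoop, hleft, hright]
  exact hframe.transportCross_scaling_mul_scaling _ _ two_ne_zero (mobius_mul_mobius _ _)

lemma line_le_perp_conjSub_iff (hl : l ≠ 0) :
    line k ≤ perp (conjSub (line l)) ↔ dual l ⬝ᵥ k = 0 := by
  rw [perp_conjSub, line, Submodule.span_singleton_le_iff_mem, line,
    Submodule.mem_orthogonal_singleton_iff_inner_right, inner_toLp, star_dotProduct_eq_zero_iff hl]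

lemma finrank_line_sup_line (hl : l ≠ 0) (hw : w ≠ 0) (hl'w : dual l ⬝ᵥ w = 0) :
    Module.finrank ℂ ↥(line l ⊔ line w) = 2 := by
  have hortho : line l ⟂ line w := by
    rw [line, line, Submodule.isOrtho_span]
    rintro _ rfl _ rfl
    rw [inner_toLp, (star_dotProduct_eq_zero_iff hl).2 hl'w]
  have hrank := Submodule.finrank_sup_add_finrank_inf_eq (line l) (line w)
  rwa [hortho.disjoint.eq_bot, finrank_bot, add_zero, line, line,
    finrank_span_singleton (by simpa using hl), finrank_span_singleton (by simpa using hw)]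
    at hrank

lemma isComplexCoassociative_line_sup_line_iff (hl : l ≠ 0) (hll : l ⬝ᵥ l = 0)
    (hww : w ⬝ᵥ w = 0) (hlw : l ⬝ᵥ w = 0) (hl'w : dual l ⬝ᵥ w = 0) :
    IsComplexCoassociative (line l ⊔ line w) ↔ w ≠ 0 ∧ cross l w = 0 := by
  have hmem {x : V} (hx : x ∈ line l ⊔ line w) :
      ∃ a b : ℂ, x = WithLp.toLp 2 (a • l + b • w) := by
    obtain ⟨_, hy, _, hz, rfl⟩ := Submodule.mem_sup.1 hx
    obtain ⟨a, rfl⟩ := Submodule.mem_span_singleton.1 hy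
    obtain ⟨b, rfl⟩ := Submodule.mem_span_singleton.1 hz
    exact ⟨a, b, rfl⟩
  constructor
  · rintro ⟨hrank, -, hprod⟩
    refine ⟨?_, ?_⟩
    · rintro rfl
      have hline : line l ⊔ line 0 = line l := by simp [line]
      rw [hline, (isIsotropicLine_line hl hll).1] at hrank
      norm_num at hrank
    · have hzero := hprod _ (Submodule.mem_sup_left (Submodule.mem_span_singleton_self _)) _
        (Submodule.mem_sup_right (Submodule.mem_span_singleton_self _))
      rw [octProd_toLp] at hzero
      exact congrArg WithLp.ofLp hzero
  · rintro ⟨hw, hcross⟩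
    refine ⟨finrank_line_sup_line hl hw hl'w, fun x hx y hy => ?_, fun x hx y hy => ?_⟩
    all_goals
      obtain ⟨a, b, rfl⟩ := hmem hx
      obtain ⟨c, d, rfl⟩ := hmem hy
    · rw [bil_toLp]
      simp [hll, hww, hlw, dotProduct_comm w l]
    · rw [octProd_toLp]
      simp [cross_self, hcross, cross_swap w l]

lemma isG2Pair_line_iff (hl : l ≠ 0) (hll : l ⬝ᵥ l = 0) (hk : k ≠ 0) (hkk : k ⬝ᵥ k = 0) :
    IsG2Pair (line l) (line k) ↔
      dual l ⬝ᵥ k = 0 ∧ perpPart l k ≠ 0 ∧ cross l (perpPart l k) = 0 := by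
  have hplane : image (projMat (perp (line l ⊔ conjSub (line l)))) (line k) =
      line (perpPart l k) := by
    rw [projMat_perp_line hl hll, image_line, perpPart]
  have hcoassociative (hlk : dual l ⬝ᵥ k = 0) :=
    isComplexCoassociative_line_sup_line_iff hl hll (perpPart_dotProduct_self hlk hl hll hkk)
      (dotProduct_perpPart hl hll k) (dual_dotProduct_perpPart hl hll k)
  constructor
  · rintro ⟨-, -, hperp, hcoass⟩
    have hlk := (line_le_perp_conjSub_iff hl).1 hperp
    exact ⟨hlk, (hcoassociative hlk).1 (hplane ▸ hcoass)⟩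
  · rintro ⟨hlk, hcoass⟩
    exact ⟨isIsotropicLine_line hl hll, isIsotropicLine_line hk hkk,
      (line_le_perp_conjSub_iff hl).2 hlk, hplane ▸ (hcoassociative hlk).2 hcoass⟩

end PairCriterion

section PoleCoefficient

variable {n : Type*} {α : ℂ}

lemma map_valueAt_map_constAt (A : Matrix n n ℂ) :
    (A.map (constAt α)).map (valueAt α) = A := by
  ext i j
  exact valueAt_constAt α (A i j)

/-- The loop `g` has at most a simple pole at `α`, with coefficient `R`. The residue is normalized
by means of the coordinate `(λ - α)/(λ - ᾱ)`. -/
def HasPoleCoeff (α : ℂ) (g : Matrix n n (RatFunc ℂ)) (R : Matrix n n ℂ) : Prop :=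
  ∃ G : Matrix n n (regularAt α),
    G.map (regularAt α).subtype = mobius α (conj α) • g ∧ G.map (valueAt α) = R

lemma HasPoleCoeff.unique {g : Matrix n n (RatFunc ℂ)} {R R' : Matrix n n ℂ}
    (h : HasPoleCoeff α g R) (h' : HasPoleCoeff α g R') : R = R' := by
  obtain ⟨G, hG, rfl⟩ := h
  obtain ⟨G', hG', rfl⟩ := h'
  rw [Matrix.map_injective (regularAt α).subtype_injective (hG.trans hG'.symm)]

lemma exists_eq_mobius_and_valueAt_eq_zero (hα : α ≠ conj α) :
    ∃ t : regularAt α, (t : RatFunc ℂ) = mobius α (conj α) ∧ valueAt α t = 0 := by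
  let t : regularAt α := ⟨_, mobius_mem_regularAt α hα⟩
  let p (a : ℂ) : regularAt α := ⟨_, algebraMap_mem_regularAt (X - C a) α⟩
  have hp (a : ℂ) : valueAt α (p a) = α - a := by
    rw [valueAt_apply, RatFunc.eval_algebraMap]
    simp
  have hmul : t * p (conj α) = p α := Subtype.ext <| by
    simp only [t, p, Subring.coe_mul, mobius_eq_div]
    exact div_mul_cancel₀ _ (by simpa using ratFunc_X_sub_C_ne_zero (conj α))
  have hvalue := congrArg (valueAt α) hmul
  rw [map_mul, hp, hp, sub_self] at hvalue
  exact ⟨t, rfl, (mul_eq_zero.1 hvalue).resolve_right (sub_ne_zero.2 hα)⟩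

variable [Fintype n] [DecidableEq n]

lemma HasPoleCoeff.mul_mul {g h h' : Matrix n n (RatFunc ℂ)} {R : Matrix n n ℂ}
    (hg : HasPoleCoeff α g R) (hh : h ∈ (regularAt α).matrix) (hh' : h' ∈ (regularAt α).matrix) :
    HasPoleCoeff α (h * g * h') (h.map (RatFunc.eval (RingHom.id ℂ) α) * R *
      h'.map (RatFunc.eval (RingHom.id ℂ) α)) := by
  obtain ⟨G, hG, rfl⟩ := hg
  obtain ⟨H, rfl, hH⟩ := exists_map_valueAt_eq hh
  obtain ⟨H', rfl, hH'⟩ := exists_map_valueAt_eq hh'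
  refine ⟨H * G * H', ?_, ?_⟩
  · rw [Matrix.map_mul, Matrix.map_mul, hG, Matrix.mul_smul, Matrix.smul_mul]
  · rw [Matrix.map_mul, Matrix.map_mul, hH, hH']

lemma HasPoleCoeff.cross_mulVec_mulVec {g : Loop} {R : Matrix (Fin 7) (Fin 7) ℂ}
    (hα : α ≠ conj α) (horth : gᵀ * g = 1) (hcross : transportCross g = cross)
    (hg : HasPoleCoeff α g R) (x y : Fin 7 → ℂ) : cross (R *ᵥ x) (R *ᵥ y) = 0 := by
  obtain ⟨t, ht, ht0⟩ := exists_eq_mobius_and_valueAt_eq_zero hα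
  obtain ⟨G, hG, rfl⟩ := hg
  have hG_mulVec (z : Fin 7 → regularAt α) : (regularAt α).subtype ∘ (G *ᵥ z) =
      mobius α (conj α) • (g *ᵥ ((regularAt α).subtype ∘ z)) := by
    rw [← smul_mulVec, ← hG]
    exact funext (RingHom.map_mulVec _ G z)
  have hregular (x y : Fin 7 → regularAt α) : cross (G *ᵥ x) (G *ᵥ y) = t • G *ᵥ cross x y := by
    refine (regularAt α).subtype_injective.comp_left ?_
    change (regularAt α).subtype ∘ _ = (regularAt α).subtype ∘ _
    rw [← cross_map, hG_mulVec, hG_mulVec, map_smul, map_smul, LinearMap.smul_apply,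
      G2Loop.cross_mulVec_mulVec horth hcross, cross_map, ← hG_mulVec, ← ht]
    rfl
  have hvalue := congrArg (valueAt α ∘ ·) (hregular (constAt α ∘ x) (constAt α ∘ y))
  have hG_value (z : Fin 7 → ℂ) :
      valueAt α ∘ (G *ᵥ (constAt α ∘ z)) = G.map (valueAt α) *ᵥ z := by
    have hz : valueAt α ∘ constAt α ∘ z = z := funext fun i => valueAt_constAt α (z i)
    refine funext fun i => ?_
    rw [Function.comp_apply, RingHom.map_mulVec, hz]
  rw [← hG_value, ← hG_value, cross_map]
  refine hvalue.trans (funext fun i => ?_)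
  simp [ht0]

end PoleCoefficient

section PairPole

variable {n : Type*} [Fintype n] [DecidableEq n] {α : ℂ} {l k : n → ℂ}

lemma exists_isotropicLoop_eq (hα : α ≠ conj α) (v : n → ℂ) :
    ∃ N : Matrix n n (regularAt α), N.map (valueAt α) = scaling 0 0 v (dual v) ∧
      isotropicLoop α v = N.map (regularAt α).subtype +
        mobius (conj α) α • (vecMulVec (dual v) v).map RatFunc.C := by
  obtain ⟨t, ht, ht0⟩ := exists_eq_mobius_and_valueAt_eq_zero hα
  have hconst (x : n → ℂ) : valueAt α ∘ constAt α ∘ x = x :=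
    funext fun i => valueAt_constAt α (x i)
  refine ⟨scaling t 0 (constAt α ∘ v) (constAt α ∘ dual v), ?_, ?_⟩
  · rw [scaling_map, ht0, map_zero, hconst, hconst]
  · rw [isotropicLoop, scaling_eq_scaling_zero_add, scaling_map, ← ht]
    ext i j
    simp only [Matrix.add_apply, Matrix.smul_apply, map_apply, vecMulVec_apply, map_mul]
    rfl

lemma exists_mobius_smul_isotropicLoop_mul_eq (hα : α ≠ conj α) (l k : n → ℂ) :
    ∃ G : Matrix n n (regularAt α),
      G.map (valueAt α) =
        vecMulVec (perpPart l (dual k)) k + vecMulVec (dual l) (perpPart k l) ∧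
      mobius α (conj α) • (isotropicLoop α l * isotropicLoop α k) =
        G.map (regularAt α).subtype +
          mobius (conj α) α • ((l ⬝ᵥ dual k) • vecMulVec (dual l) k).map RatFunc.C := by
  obtain ⟨t, ht, ht0⟩ := exists_eq_mobius_and_valueAt_eq_zero hα
  obtain ⟨Nl, hNl, hl⟩ := exists_isotropicLoop_eq hα l
  obtain ⟨Nk, hNk, hk⟩ := exists_isotropicLoop_eq hα k
  let E (v : n → ℂ) : Matrix n n (regularAt α) := (vecMulVec (dual v) v).map (constAt α)
  have hE_value (v : n → ℂ) : (E v).map (valueAt α) = vecMulVec (dual v) v :=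
    map_valueAt_map_constAt _
  have hE (v : n → ℂ) :
      (vecMulVec (dual v) v).map RatFunc.C = (E v).map (regularAt α).subtype := rfl
  have hE_mul : ((l ⬝ᵥ dual k) • vecMulVec (dual l) k).map RatFunc.C =
      (E l).map (regularAt α).subtype * (E k).map (regularAt α).subtype := by
    rw [← vecMulVec_smul, ← vecMulVec_mul_vecMulVec, Matrix.map_mul, hE, hE]
  have hts : mobius α (conj α) * mobius (conj α) α = 1 := mobius_mul_mobius _ _
  refine ⟨t • (Nl * Nk) + Nl * E k + E l * Nk, ?_, ?_⟩
  · rw [Matrix.map_add _ (map_add _), Matrix.map_add _ (map_add _),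
      Matrix.map_smul' _ _ _ (map_mul _), ht0, zero_smul, zero_add, Matrix.map_mul, Matrix.map_mul,
      hNl, hNk, hE_value, hE_value, mul_vecMulVec, vecMulVec_mul, ← mulVec_transpose,
      transpose_scaling, perpPart, perpPart]
  · rw [hl, hk, hE, hE, hE_mul, Matrix.map_add _ (map_add _), Matrix.map_add _ (map_add _),
      Matrix.map_smul' _ _ _ (map_mul _), Matrix.map_mul, Matrix.map_mul, Matrix.map_mul,
      Subring.subtype_apply, ht]
    simp only [add_mul, mul_add, Matrix.smul_mul, Matrix.mul_smul, smul_add, smul_smul, hts,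
      one_smul, ← mul_assoc, one_mul]
    abel

lemma hasPoleCoeff_isotropicLoop_mul (hα : α ≠ conj α) (hlk : l ⬝ᵥ dual k = 0) :
    HasPoleCoeff α (isotropicLoop α l * isotropicLoop α k)
      (vecMulVec (perpPart l (dual k)) k + vecMulVec (dual l) (perpPart k l)) := by
  obtain ⟨G, hvalue, hG⟩ := exists_mobius_smul_isotropicLoop_mul_eq hα l k
  refine ⟨G, ?_, hvalue⟩
  rw [hG, hlk]
  simp

lemma HasPoleCoeff.dotProduct_dual_eq_zero (hα : α ≠ conj α) (hl : l ≠ 0) (hk : k ≠ 0)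
    {R : Matrix n n ℂ} (h : HasPoleCoeff α (isotropicLoop α l * isotropicLoop α k) R) :
    l ⬝ᵥ dual k = 0 := by
  obtain ⟨t, ht, ht0⟩ := exists_eq_mobius_and_valueAt_eq_zero hα
  obtain ⟨G, -, hG⟩ := exists_mobius_smul_isotropicLoop_mul_eq hα l k
  obtain ⟨G', hG', -⟩ := h
  set A := (l ⬝ᵥ dual k) • vecMulVec (dual l) k with hA
  have hregular : t • G' = t • G + A.map (constAt α) := by
    refine Matrix.map_injective (regularAt α).subtype_injective ?_
    beta_reduce
    rw [Matrix.map_add _ (map_add _), Matrix.map_smul' _ _ _ (map_mul _),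
      Matrix.map_smul' _ _ _ (map_mul _), hG', hG, Subring.subtype_apply, ht, smul_add, smul_smul,
      mobius_mul_mobius, one_smul]
    rfl
  have hvalue := congrArg (Matrix.map · (valueAt α)) hregular
  simp only [Matrix.map_add _ (map_add _), Matrix.map_smul' _ _ _ (map_mul _), ht0, zero_smul,
    zero_add, map_valueAt_map_constAt] at hvalue
  exact (smul_eq_zero.1 (hA ▸ hvalue.symm)).resolve_right (vecMulVec_ne_zero (dual_ne_zero hl) hk)

end PairPole

section Characterization

variable {α : ℂ} {l k : Fin 7 → ℂ} {L K : Submodule ℂ V}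

lemma exists_ne_zero_hasPoleCoeff_isotropicLoop_mul (hα : α ≠ conj α) (hl : l ≠ 0) (hk : k ≠ 0)
    (hkk : k ⬝ᵥ k = 0) (hlk : dual l ⬝ᵥ k = 0) (hw : perpPart l k ≠ 0) :
    ∃ R ≠ 0, HasPoleCoeff α (isotropicLoop α l * isotropicLoop α k) R := by
  have hlk' : l ⬝ᵥ dual k = 0 :=
    (dotProduct_comm _ _).trans ((dual_dotProduct_eq_zero_comm hl hk).1 hlk)
  refine ⟨_, fun hR => ?_, hasPoleCoeff_isotropicLoop_mul hα hlk'⟩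
  have hdual := congrArg (· *ᵥ dual k) hR
  simp only [add_mulVec, vecMulVec_mulVec, zero_mulVec, dotProduct_comm (perpPart k l),
    dual_dotProduct_perpPart hk hkk, (isHyperbolicPair_dual hk hkk).dotProduct_eq_one,
    MulOpposite.op_one, MulOpposite.op_zero, one_smul, zero_smul, add_zero] at hdual
  rw [perpPart_dual hl] at hdual
  exact smul_ne_zero (inv_ne_zero (star_dotProduct_self_ne_zero hk)) (star_ne_zero.2 hw) hdual

lemma isG2Pair_line_of_hasPoleCoeff (hα : α ≠ conj α) (hl : l ≠ 0) (hll : l ⬝ᵥ l = 0) (hk : k ≠ 0)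
    (hkk : k ⬝ᵥ k = 0) (horth : (isotropicLoop α l * isotropicLoop α k)ᵀ *
      (isotropicLoop α l * isotropicLoop α k) = 1)
    (hcross : transportCross (isotropicLoop α l * isotropicLoop α k) = cross)
    {R : Matrix (Fin 7) (Fin 7) ℂ} (hR : R ≠ 0)
    (hpole : HasPoleCoeff α (isotropicLoop α l * isotropicLoop α k) R) :
    IsG2Pair (line l) (line k) := by
  have hlk' := hpole.dotProduct_dual_eq_zero hα hl hk
  have hlk : dual l ⬝ᵥ k = 0 :=
    (dual_dotProduct_eq_zero_comm hl hk).2 ((dotProduct_comm _ _).trans hlk')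
  obtain rfl := hpole.unique (hasPoleCoeff_isotropicLoop_mul hα hlk')
  have hw : perpPart l k ≠ 0 := fun h => hR <| by
    rw [perpPart_dual hl, h, perpPart_eq_zero_symm hlk hk hkk h]
    simp
  obtain ⟨i, hi⟩ := Function.ne_iff.1 ((perpPart_eq_zero_iff_symm hlk hl hll hk hkk).not.1 hw)
  have hdual : cross (dual l) (perpPart l (dual k)) = 0 := by
    have hprod := hpole.cross_mulVec_mulVec hα horth hcross (Pi.single i 1) (dual k)
    simp only [add_mulVec, vecMulVec_mulVec, op_smul_eq_smul, dotProduct_single_one,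
      dotProduct_comm (perpPart k l) (dual k), dual_dotProduct_perpPart hk hkk,
      (isHyperbolicPair_dual hk hkk).dotProduct_eq_one, one_smul, zero_smul, add_zero, map_add,
      map_smul, LinearMap.add_apply, LinearMap.smul_apply, cross_self, smul_zero, zero_add]
      at hprod
    exact (smul_eq_zero.1 hprod).resolve_left hi
  rw [dual, perpPart_dual hl, map_smul, map_smul, LinearMap.smul_apply, cross_star_star] at hdual
  have hstar := (smul_eq_zero.1 hdual).resolve_left
    (inv_ne_zero (star_dotProduct_self_ne_zero hk))
  have hcross_eq := (smul_eq_zero.1 hstar).resolve_left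
    (inv_ne_zero (star_dotProduct_self_ne_zero hl))
  exact (isG2Pair_line_iff hl hll hk hkk).2 ⟨hlk, hw, star_eq_zero.1 hcross_eq⟩

lemma pairLoop_line (α : ℂ) (hl : l ≠ 0) (hll : l ⬝ᵥ l = 0) (hk : k ≠ 0) (hkk : k ⬝ᵥ k = 0) :
    pairLoop α (line l) (line k) = isotropicLoop α l * isotropicLoop α k := by
  rw [pairLoop, simpleLoop_line α hl hll, simpleLoop_line α hk hkk]

lemma IsIsotropicLine.isNormalizedLoop_simpleLoop (α : ℂ) (hL : IsIsotropicLine L) :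
    IsNormalizedLoop {α, conj α} (simpleLoop α L) := by
  obtain ⟨l, hl, hll, rfl⟩ := hL.exists_eq_line
  rw [simpleLoop_line α hl hll]
  exact isNormalizedLoop_isotropicLoop α hl hll

lemma IsIsotropicLine.isNormalizedLoop_pairLoop (α : ℂ) (hL : IsIsotropicLine L)
    (hK : IsIsotropicLine K) :
    IsNormalizedLoop {α, conj α} (pairLoop α L K) :=
  Set.union_self {α, conj α} ▸
    (hL.isNormalizedLoop_simpleLoop α).mul (hK.isNormalizedLoop_simpleLoop α)

lemma IsG2Pair.isNormalizedLoop_pairLoop (α : ℂ) (h : IsG2Pair L K) :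
    IsNormalizedLoop {α, conj α} (pairLoop α L K) :=
  h.isotropicLine_left.isNormalizedLoop_pairLoop α h.isotropicLine_right

lemma IsG2Pair.transportCross_pairLoop (α : ℂ) (h : IsG2Pair L K) :
    transportCross (pairLoop α L K) = cross := by
  obtain ⟨l, hl, hll, rfl⟩ := h.isotropicLine_left.exists_eq_line
  obtain ⟨k, hk, hkk, rfl⟩ := h.isotropicLine_right.exists_eq_line
  obtain ⟨hlk, hw, hcross⟩ := (isG2Pair_line_iff hl hll hk hkk).1 h
  rw [pairLoop_line α hl hll hk hkk]
  exact transportCross_isotropicLoop_mul α hl hll hk hkk hlk hw hcross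

lemma isG2Pair_iff (hα : α ≠ conj α) (hL : IsIsotropicLine L) (hK : IsIsotropicLine K) :
    IsG2Pair L K ↔ transportCross (pairLoop α L K) = cross ∧
      ∃ R ≠ 0, HasPoleCoeff α (pairLoop α L K) R := by
  refine ⟨fun h => ⟨h.transportCross_pairLoop α, ?_⟩, ?_⟩
  all_goals
    have horth := (hL.isNormalizedLoop_pairLoop α hK).transpose_mul_self
    obtain ⟨l, hl, hll, rfl⟩ := hL.exists_eq_line
    obtain ⟨k, hk, hkk, rfl⟩ := hK.exists_eq_line
    rw [pairLoop_line α hl hll hk hkk] at *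
  · obtain ⟨hlk, hw, -⟩ := (isG2Pair_line_iff hl hll hk hkk).1 h
    exact exists_ne_zero_hasPoleCoeff_isotropicLoop_mul hα hl hk hkk hlk hw
  · rintro ⟨hcross, R, hR, hpole⟩
    exact isG2Pair_line_of_hasPoleCoeff hα hl hll hk hkk horth hcross hR hpole

end Characterization

section Transport

variable {R : Type*} [CommRing R]

lemma transportCross_map_single {R' : Type*} [CommRing R'] (f : R →+* R')
    (A : Matrix (Fin 7) (Fin 7) R) (i j : Fin 7) :
    transportCross (A.map f) (Pi.single i 1) (Pi.single j 1) =
      f ∘ transportCross A (Pi.single i 1) (Pi.single j 1) := by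
  have hsingle (i : Fin 7) : Pi.single i (1 : R') = f ∘ Pi.single i (1 : R) := by
    ext j
    simp [Pi.single_apply, apply_ite f]
  rw [hsingle, hsingle, transportCross_map]

lemma transportCross_single_mem {S : Subring R} {A : Matrix (Fin 7) (Fin 7) R} (hA : A ∈ S.matrix)
    (i j m : Fin 7) : transportCross A (Pi.single i 1) (Pi.single j 1) m ∈ S := by
  let B : Matrix (Fin 7) (Fin 7) S := of fun i j => ⟨A i j, hA i j⟩
  rw [show A = B.map S.subtype from rfl, transportCross_map_single]
  exact Subtype.property _

variable {P Q : Set ℂ} {g h : Loop}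

lemma IsNormalizedLoop.transportCross_eq_cross (hg : IsNormalizedLoop P g)
    (hh : IsNormalizedLoop Q h) (hPQ : Disjoint P Q)
    (heq : transportCross g = transportCross h) : transportCross g = cross := by
  have hmem (z : ℂ) (i j m : Fin 7) :
      transportCross g (Pi.single i 1) (Pi.single j 1) m ∈ regularAt z := by
    by_cases hz : z ∈ P
    · rw [heq]
      exact transportCross_single_mem (hh.mem_regularAt z (hPQ.notMem_of_mem_left hz)) i j m
    · exact transportCross_single_mem (hg.mem_regularAt z hz) i j m
  obtain ⟨G, rfl, hG⟩ := hg.exists_residue_eq_one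
  refine (Pi.basisFun _ _).ext fun i => (Pi.basisFun _ _).ext fun j => funext fun m => ?_
  rw [Pi.basisFun_apply, Pi.basisFun_apply, ← transportCross_one, ← sub_eq_zero]
  let f : regularAtInfty ℂ := transportCross G (Pi.single i 1) (Pi.single j 1) m -
    transportCross 1 (Pi.single i 1) (Pi.single j 1) m
  have hf : (f : RatFunc ℂ) =
      transportCross (G.map (regularAtInfty ℂ).subtype) (Pi.single i 1) (Pi.single j 1) m -
        transportCross 1 (Pi.single i 1) (Pi.single j 1) m := by
    rw [← Matrix.map_one (regularAtInfty ℂ).subtype (map_zero _) (map_one _),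
      transportCross_map_single, transportCross_map_single]
    rfl
  have hresidue : IsLocalRing.residue _ f = 0 := by
    have hvalue (A : Matrix (Fin 7) (Fin 7) (regularAtInfty ℂ)) :=
      congrFun (transportCross_map_single (IsLocalRing.residue _) A i j) m
    rw [map_sub, sub_eq_zero]
    refine (hvalue G).symm.trans (Eq.trans ?_ (hvalue 1))
    rw [hG, Matrix.map_one _ (map_zero _) (map_one _)]
  have hf0 : f = 0 := eq_zero_of_forall_mem_regularAt
    (fun z => hf ▸ sub_mem (hmem z i j m) (transportCross_single_mem (one_mem _) i j m)) hresidue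
  rw [← hf, hf0]
  rfl

lemma IsNormalizedLoop.factorization_unique {p p' q q' : Loop} (hp : IsNormalizedLoop P p)
    (hp' : IsNormalizedLoop P p') (hq : IsNormalizedLoop Q q) (hq' : IsNormalizedLoop Q q')
    (hPQ : Disjoint P Q) (hh : h * hᵀ = 1) (hg : g * gᵀ = 1) (h₁ : p * h = q * g)
    (h₂ : p' * h = q' * g) : q = q' := by
  have hquot : q * q'ᵀ = p * p'ᵀ := by
    have := congrArg₂ (fun a b => a * bᵀ) h₁ h₂
    simp only [transpose_mul, Matrix.mul_assoc] at this
    rw [← Matrix.mul_assoc h, hh, ← Matrix.mul_assoc g, hg, Matrix.one_mul, Matrix.one_mul] at this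
    exact this.symm
  have hone : q * q'ᵀ = 1 := by
    have hQ := hq.mul hq'.transpose
    have hP := hp.mul hp'.transpose
    rw [Set.union_self] at hQ hP
    exact (hquot ▸ hP).eq_one hQ hPQ
  rw [← Matrix.one_mul q', ← hone, Matrix.mul_assoc, hq'.transpose_mul_self, Matrix.mul_one]

end Transport

section G2Dressing

variable {P : Set ℂ} {α : ℂ} {h h' : Loop} {L K L' K' : Submodule ℂ V}

lemma disjoint_pair_conj {α β : ℂ} (h : α ≠ β) (h' : α ≠ conj β) :
    Disjoint ({α, conj α} : Set ℂ) {β, conj β} := by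
  have hconj : conj α ≠ conj β := (starRingEnd ℂ).injective.ne h
  have hconj' : conj α ≠ β := fun hαβ => h' (hαβ ▸ (Complex.conj_conj α).symm)
  simp [h.symm, h'.symm, hconj.symm, hconj'.symm]

lemma IsNormalizedLoop.dress_image (hα : α ≠ conj α) (hh : IsNormalizedLoop P h) (hαP : α ∉ P)
    (hK : IsIsotropicLine K) (hK' : K' = image (evalAt h α) K) :
    IsIsotropicLine K' ∧ IsNormalizedLoop P (dress α K' h) ∧
      dress α K' h * simpleLoop α K = simpleLoop α K' * h := by
  obtain ⟨k, hk, hkk, rfl⟩ := hK.exists_eq_line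
  have horth := hh.transpose_evalAt_mul_evalAt hαP
  have hne := ne_zero_of_transpose_mul_self_eq_one horth hk
  have hiso : (evalAt h α *ᵥ k) ⬝ᵥ (evalAt h α *ᵥ k) = 0 := by
    rw [mulVec_dotProduct_mulVec horth, hkk]
  rw [hK', hh.dress_image_line hαP hk hkk, image_line, simpleLoop_line α hk hkk,
    simpleLoop_line α hne hiso, Matrix.mul_assoc _ _ (isotropicLoop α k),
    (isNormalizedLoop_isotropicLoop α hk hkk).transpose_mul_self, Matrix.mul_one]
  exact ⟨isIsotropicLine_line hne hiso, hh.isotropicLoop_mul_mul hα hαP hk hkk, rfl⟩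

lemma IsG2Pair.of_pairLoop_mul_eq (hα : α ≠ conj α) (hLK : IsG2Pair L K)
    (hh : IsNormalizedLoop P h) (hh' : IsNormalizedLoop P h') (hP : Disjoint {α, conj α} P)
    (hcross : transportCross h = cross) (hL' : IsIsotropicLine L') (hK' : IsIsotropicLine K')
    (heq : pairLoop α L' K' * h = h' * pairLoop α L K) : IsG2Pair L' K' := by
  have hαP : α ∉ P := hP.notMem_of_mem_left (.inl rfl)
  have htransport : transportCross (pairLoop α L' K') = transportCross h' := by
    rw [← transportCross_mul _ hcross, heq, transportCross_mul _ (hLK.transportCross_pairLoop α)]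
  obtain ⟨-, R, hR, hpole⟩ :=
    (isG2Pair_iff hα hLK.isotropicLine_left hLK.isotropicLine_right).1 hLK
  have hpole' := hpole.mul_mul (hh'.mem_regularAt α hαP) (transpose_mem (hh.mem_regularAt α hαP))
  rw [← heq, Matrix.mul_assoc, hh.mul_transpose_self, Matrix.mul_one] at hpole'
  refine (isG2Pair_iff hα hL' hK').2
    ⟨(hL'.isNormalizedLoop_pairLoop α hK').transportCross_eq_cross hh' hP htransport,
      _, fun hzero => hR ?_, hpole'⟩
  have horth := hh.transpose_evalAt_mul_evalAt hαP
  have horth' := hh'.transpose_evalAt_mul_evalAt hαP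
  have hcancel : (evalAt h' α)ᵀ * (evalAt h' α * R * (evalAt h α)ᵀ) * evalAt h α = R := by
    rw [Matrix.mul_assoc, Matrix.mul_assoc (evalAt h' α * R), horth, Matrix.mul_one,
      ← Matrix.mul_assoc, horth', Matrix.one_mul]
  have hcoeff : evalAt h' α * R * (evalAt h α)ᵀ = 0 := hzero
  rw [← hcancel, hcoeff, Matrix.mul_zero, Matrix.zero_mul]

lemma IsG2Pair.dress_image (hα : α ≠ conj α) (hLK : IsG2Pair L K) (hh : IsNormalizedLoop P h)
    (hP : Disjoint {α, conj α} P) (hcross : transportCross h = cross)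
    (hK' : K' = image (evalAt h α) K) (hL' : L' = image (evalAt (dress α K' h) α) L) :
    IsHolomorphicAt (dress α K' h) α ∧ IsG2Pair L' K' ∧
      IsNormalizedLoop P (dress α L' (dress α K' h)) ∧
      pairLoop α L' K' * h = dress α L' (dress α K' h) * pairLoop α L K := by
  have hαP : α ∉ P := hP.notMem_of_mem_left (.inl rfl)
  obtain ⟨hK'_iso, hdressK, hmulK⟩ := hh.dress_image hα hαP hLK.isotropicLine_right hK'
  obtain ⟨hL'_iso, hdressL, hmulL⟩ := hdressK.dress_image hα hαP hLK.isotropicLine_left hL'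
  have heq : pairLoop α L' K' * h = dress α L' (dress α K' h) * pairLoop α L K := by
    rw [pairLoop, pairLoop, Matrix.mul_assoc, ← hmulK, ← Matrix.mul_assoc, ← hmulL,
      Matrix.mul_assoc]
  exact ⟨hdressK.isHolomorphicAt hαP,
    hLK.of_pairLoop_mul_eq hα hh hdressL hP hcross hL'_iso hK'_iso heq, hdressL, heq⟩

end G2Dressing

end G2Loop

end


theorem mainTheorem8 (α β : ℂ) (hα : α.im ≠ 0) (hβ : β.im ≠ 0)
    (hαβ : α ≠ β) (hαβ' : α ≠ starRingEnd ℂ β)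
    (L K M N : Submodule ℂ G2Loop.V)
    (hLK : G2Loop.IsG2Pair L K) (hMN : G2Loop.IsG2Pair M N) :
    -- the loops that are evaluated below are holomorphic at the point in question
    G2Loop.IsHolomorphicAt (G2Loop.pairLoop β M N) α ∧
    G2Loop.IsHolomorphicAt (G2Loop.pairLoop α L K) β ∧
    ∀ K' L' N' M' : Submodule ℂ G2Loop.V,
      K' = G2Loop.image (G2Loop.evalAt (G2Loop.pairLoop β M N) α) K →
      L' = G2Loop.image
        (G2Loop.evalAt (G2Loop.dress α K' (G2Loop.pairLoop β M N)) α) L →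
      N' = G2Loop.image (G2Loop.evalAt (G2Loop.pairLoop α L K) β) N →
      M' = G2Loop.image
        (G2Loop.evalAt (G2Loop.dress β N' (G2Loop.pairLoop α L K)) β) M →
      G2Loop.IsHolomorphicAt (G2Loop.dress α K' (G2Loop.pairLoop β M N)) α ∧
      G2Loop.IsHolomorphicAt (G2Loop.dress β N' (G2Loop.pairLoop α L K)) β ∧
      G2Loop.IsG2Pair L' K' ∧ G2Loop.IsG2Pair M' N' ∧
      G2Loop.pairLoop α L' K' * G2Loop.pairLoop β M N =
        G2Loop.pairLoop β M' N' * G2Loop.pairLoop α L K := by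
  have hα' : α ≠ starRingEnd ℂ α := fun h => hα (Complex.conj_eq_iff_im.1 h.symm)
  have hβ' : β ≠ starRingEnd ℂ β := fun h => hβ (Complex.conj_eq_iff_im.1 h.symm)
  have hdisjoint := G2Loop.disjoint_pair_conj hαβ hαβ'
  have hp := hLK.isNormalizedLoop_pairLoop α
  have hq := hMN.isNormalizedLoop_pairLoop β
  refine ⟨hq.isHolomorphicAt (hdisjoint.notMem_of_mem_left (.inl rfl)),
    hp.isHolomorphicAt (hdisjoint.notMem_of_mem_right (.inl rfl)),
    fun K' L' N' M' hK hL hN hM => ?_⟩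
  obtain ⟨hholα, hLK', hq', hpq⟩ :=
    hLK.dress_image hα' hq hdisjoint (hMN.transportCross_pairLoop β) hK hL
  obtain ⟨hholβ, hMN', hp', hqp⟩ :=
    hMN.dress_image hβ' hp hdisjoint.symm (hLK.transportCross_pairLoop α) hN hM
  refine ⟨hholα, hholβ, hLK', hMN', ?_⟩
  have hfactor := (hLK'.isNormalizedLoop_pairLoop α).factorization_unique hp' hq'
    (hMN'.isNormalizedLoop_pairLoop β) hdisjoint hq.mul_transpose_self hp.mul_transpose_self
    hpq hqp.symm
  rw [hpq, hfactor]
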